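/- **Theorem 1.3.** Consider two matroids $\mathcal M_1=(V,\mathcal I_1)$ and $\mathcal M_2=(V,\mathcal I_2)$ on a common ground set $V$ with $n=|V|<\infty$, and let $r=\max\{|S| : S\in\mathcal I_1\cap\mathcal I_2\}$. A parallel query algorithm knows $V$ but accesses the matroids only through oracles, and works in rounds. In every round it issues at most $\mathrm{poly}(n)$ queries simultaneously; each query names one of the two matroids and a set $S\subseteq V$, and may depend only on the answers of earlier rounds. A rank query returns the rank of $S$ in the named matroid (the size of a largest independent subset of $S$); an independence query returns whether $S$ is independent in it. The number $r$ is not given to the algorithm. There are deterministic parallel query algorithms that, on every such pair of matroids, output a common independent set $S\in\mathcal I_1\cap\mathcal I_2$ of maximum size $|S|=r$ and use 1. with rank queries, at most $C\,\bigl(1+n^{1/3}r^{1/3}\bigr)$ rounds; 2. with independence queries, at most $C\,\bigl(1+n^{1/3}r^{1/2}\,(1+\log(n/r))\bigr)$ rounds. Here $C$ is an absolute constant, the polynomial bounding the number of queries per round is fixed, and for $r=0$ the products $n^{1/3}r^{1/3}$ and $n^{1/3}r^{1/2}(1+\log(n/r))$ are read as $0$. -/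

import Mathlib

/-- A deterministic parallel (round-based, adaptive) query algorithm, in the standard query model.
`Q` is the type of queries, `A` the type of oracle answers, `O` the type of outputs.
An algorithm either halts with an output, or issues a finite set `queries` of queries simultaneously
and continues depending on all the answers. Hence the queries of a round may depend on the answers
given in earlier rounds, but not on each other's answers. Only queries are accounted for. -/
inductive ParallelAlg (Q : Type*) (A : Type*) (O : Type*) where
  | output (result : O) : ParallelAlg Q A O
  | round (queries : Finset Q) (next : ({q // q ∈ queries} → A) → ParallelAlg Q A O) :
      ParallelAlg Q A O

namespace ParallelAlg

variable {Q A O : Type*}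

/-- The output when all queries are answered by `oracle`. -/
def run (oracle : Q → A) : ParallelAlg Q A O → O
  | output x => x
  | round _ next => run oracle (next fun q => oracle q.1)

/-- The number of rounds of queries executed when all queries are answered by `oracle`. -/
def rounds (oracle : Q → A) : ParallelAlg Q A O → ℕ
  | output _ => 0
  | round _ next => rounds oracle (next fun q => oracle q.1) + 1

/-- The largest number of queries issued in one round when all queries are answered by `oracle`. -/
def maxQueries (oracle : Q → A) : ParallelAlg Q A O → ℕ
  | output _ => 0
  | round qs next => max qs.card (maxQueries oracle (next fun q => oracle q.1))

end ParallelAlg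

namespace MatroidIntersection

/-- A query to one of two matroids on the ground set `V`: the index of the matroid, and a set. -/
abbrev Query (V : Type*) := Fin 2 × Finset V

/-- The rank oracles of `M₁` and `M₂`: a query `(i, S)` is answered by the rank of `S` in the
`i`-th matroid, i.e. the size of a largest independent subset of `S`. (Queries are finite sets, so
the rank is finite and `toNat` loses nothing.) -/
noncomputable def rankOracle {V : Type*} (M₁ M₂ : Matroid V) : Query V → ℕ :=
  fun q => ((![M₁, M₂] q.1).eRk (q.2 : Set V)).toNat

open Classical in
/-- The independence oracles of `M₁` and `M₂`: a query `(i, S)` is answered by whether `S` is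
independent in the `i`-th matroid. -/
noncomputable def indepOracle {V : Type*} (M₁ M₂ : Matroid V) : Query V → Bool :=
  fun q => decide ((![M₁, M₂] q.1).Indep (q.2 : Set V))

/-- `S` is a common independent set of `M₁` and `M₂`. -/
def IsCommonIndep {V : Type*} (M₁ M₂ : Matroid V) (S : Finset V) : Prop :=
  M₁.Indep (S : Set V) ∧ M₂.Indep (S : Set V)

/-- `S` solves matroid intersection: it is a common independent set of the largest size. -/
def IsMaxCommonIndep {V : Type*} (M₁ M₂ : Matroid V) (S : Finset V) : Prop :=
  IsCommonIndep M₁ M₂ S ∧ ∀ T : Finset V, IsCommonIndep M₁ M₂ T → T.card ≤ S.card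

open Classical in
/-- The size `r` of the largest common independent set of two matroids on a finite type. -/
noncomputable def answerSize {V : Type*} [Fintype V] (M₁ M₂ : Matroid V) : ℕ :=
  (Finset.univ.filter fun S : Finset V => IsCommonIndep M₁ M₂ S).sup Finset.card

end MatroidIntersection

/-! An auction finds a nearly maximum common independent set, and augmentations supply what is
missing. The auction keeps a count per element and gives it the weight `k - count / 2` in the first
matroid and `(count + 1) / 2` in the second; together these are `k` or `k + 1`. A greedy basis is
determined by the ranks of the prefixes of an order known in advance, so one round of rank queries
yields both `left`, greedy for the first weight, and `right`, greedy for the second. The elements of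
`left \ right` are then raised. Counts never exceed `2 * k`, so within `2 * k * n / Δ + 1` rounds
some state has `(left \ right).card ≤ Δ`. There weak duality for the split weight
(`Invariant.mul_card_le`) shows that `right`, a common independent set because it stays inside
`left`, misses the optimum by at most `Δ + right.card / k`. Each missing element costs one round:
all arcs of the exchange graph can be queried at once, and augmenting along a shortest path keeps
independence (`IsShortest.isCommonIndep`).

For matroids truncated at `t`, taking `Δ ≈ z` and `k ≈ t / z` gives about `n * t / z ^ 2 + n / z`
auction rounds and `z` augmentations. With rank queries `z = (n * t) ^ (1 / 3)` balances this. With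
independence queries a rank cut off at `t` costs about `√t * (1 + log (n / t))` rounds
(`exists_rank_by_indep`), and `z = n ^ (1 / 3) * t ^ (1 / 2)` is used. When `t` is too small for the
term `n / z` to be harmless, `t` augmentations alone are cheap enough.

The size `r` is unknown, but an optimum of the truncation that has fewer than `t` elements is an
optimum of the original problem (`IsMaxCommonIndep.of_truncateTo`). So a guess can be checked, and
doubling the round budget (`exists_search`) costs only a constant factor over the guess `t = r + 1`.
-/

namespace ParallelAlg

/-! ### Parallel query algorithms: composition, lockstep execution, simulation, search -/

variable {Q Q' A A' O O' : Type*}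

/-- `Within N T alg`: whatever the answers are, `alg` halts after at most `T` rounds, each of them
with at most `N` queries. -/
inductive Within (N : ℕ) : ℕ → ParallelAlg Q A O → Prop
  | output (T : ℕ) (x : O) : Within N T (output x)
  | round (T : ℕ) (qs : Finset Q) (next : ({q // q ∈ qs} → A) → ParallelAlg Q A O)
      (hqs : qs.card ≤ N) (hnext : ∀ ans, Within N T (next ans)) : Within N (T + 1) (round qs next)

theorem Within.mono {N N' T T' : ℕ} {a : ParallelAlg Q A O} (h : Within N T a) (hN : N ≤ N')
    (hT : T ≤ T') : Within N' T' a := by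
  induction h generalizing T' with
  | output T x => exact .output _ _
  | round T qs next hqs hnext ih =>
    obtain ⟨T', rfl⟩ : ∃ k, T' = k + 1 := ⟨T' - 1, by omega⟩
    exact .round _ _ _ (hqs.trans hN) fun ans => ih ans (by omega)

theorem Within.rounds_le {N T : ℕ} {a : ParallelAlg Q A O} (h : Within N T a) (oracle : Q → A) :
    a.rounds oracle ≤ T := by
  induction h with
  | output T x => simp [rounds]
  | round T qs next hqs hnext ih => simpa [rounds] using ih _

theorem Within.maxQueries_le {N T : ℕ} {a : ParallelAlg Q A O} (h : Within N T a)
    (oracle : Q → A) : a.maxQueries oracle ≤ N := by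
  induction h with
  | output T x => simp [maxQueries]
  | round T qs next hqs hnext ih => simpa [maxQueries] using ⟨hqs, ih _⟩

/-- Run an algorithm and continue with its output. -/
def bind : ParallelAlg Q A O → (O → ParallelAlg Q A O') → ParallelAlg Q A O'
  | output x, f => f x
  | round qs next, f => round qs fun ans => bind (next ans) f

theorem run_bind (oracle : Q → A) (a : ParallelAlg Q A O) (f : O → ParallelAlg Q A O') :
    (a.bind f).run oracle = (f (a.run oracle)).run oracle := by
  induction a with
  | output x => rfl
  | round qs next ih => simpa [bind, run] using ih _

theorem rounds_bind (oracle : Q → A) (a : ParallelAlg Q A O) (f : O → ParallelAlg Q A O') :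
    (a.bind f).rounds oracle = a.rounds oracle + (f (a.run oracle)).rounds oracle := by
  induction a with
  | output x => simp [bind, run, rounds]
  | round qs next ih => simp only [bind, run, rounds, ih]; omega

theorem maxQueries_bind (oracle : Q → A) (a : ParallelAlg Q A O) (f : O → ParallelAlg Q A O') :
    (a.bind f).maxQueries oracle =
      max (a.maxQueries oracle) ((f (a.run oracle)).maxQueries oracle) := by
  induction a with
  | output x => simp [bind, run, maxQueries]
  | round qs next ih => simp only [bind, run, maxQueries, ih, max_assoc]

theorem Within.bind {N T T' : ℕ} {a : ParallelAlg Q A O} {f : O → ParallelAlg Q A O'}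
    (ha : Within N T a) (hf : ∀ x, Within N T' (f x)) : Within N (T + T') (a.bind f) := by
  induction ha with
  | output T x => exact (hf x).mono le_rfl (by omega)
  | round T qs next hqs hnext ih =>
    rw [Nat.add_right_comm]
    exact .round _ _ _ hqs ih

open Classical in
/-- Ask a set of queries in one round; the answers to other queries are filled in arbitrarily. -/
noncomputable def ask [Inhabited A] (qs : Finset Q) : ParallelAlg Q A (Q → A) :=
  round qs fun ans => output fun q => if h : q ∈ qs then ans ⟨q, h⟩ else default

theorem run_ask [Inhabited A] (qs : Finset Q) (oracle : Q → A) {q : Q} (hq : q ∈ qs) :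
    (ask qs).run oracle q = oracle q := by
  simp [ask, run, hq]

theorem within_ask [Inhabited A] (qs : Finset Q) : Within qs.card 1 (ask (A := A) qs) :=
  .round _ _ _ le_rfl fun _ => .output _ _

/-- Repeat a step `m` times. -/
def iter (step : O → ParallelAlg Q A O) : ℕ → O → ParallelAlg Q A O
  | 0, s => output s
  | m + 1, s => (step s).bind (iter step m)

theorem run_iter (oracle : Q → A) (step : O → ParallelAlg Q A O) (m : ℕ) (s : O) :
    (iter step m s).run oracle = (fun s => (step s).run oracle)^[m] s := by
  induction m generalizing s with
  | zero => rfl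
  | succ m ih => simp [iter, run_bind, ih]

theorem within_iter {N T : ℕ} {step : O → ParallelAlg Q A O} (h : ∀ s, Within N T (step s))
    (m : ℕ) (s : O) : Within N (m * T) (iter step m s) := by
  induction m generalizing s with
  | zero => exact .output _ _
  | succ m ih => exact ((h s).bind ih).mono le_rfl (by linarith [Nat.succ_mul m T])

/-- The queries of the first round. -/
def head : ParallelAlg Q A O → Finset Q
  | output _ => ∅
  | round qs _ => qs

/-- What remains after the first round. -/
def child : (a : ParallelAlg Q A O) → ({q // q ∈ a.head} → A) → ParallelAlg Q A O
  | output x, _ => output x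
  | round _ next, ans => next ans

theorem run_child (oracle : Q → A) (a : ParallelAlg Q A O) :
    (a.child fun q => oracle q.1).run oracle = a.run oracle := by
  cases a <;> rfl

/-- Finitely many algorithms can be run in lockstep. -/
theorem exists_parallel {ι : Type*} [Fintype ι] {N : ℕ} (T : ℕ) (a : ι → ParallelAlg Q A O)
    (ha : ∀ i, Within N T (a i)) :
    ∃ b : ParallelAlg Q A (ι → O), Within (Fintype.card ι * N) T b ∧
      ∀ oracle i, b.run oracle i = (a i).run oracle := by
  classical
  induction T generalizing a with
  | zero =>
    have : ∀ i, ∃ x, a i = output x := fun i => by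
      have := ha i
      generalize a i = b at this
      cases this
      exact ⟨_, rfl⟩
    choose x hx using this
    exact ⟨output x, .output _ _, fun oracle i => by simp [hx, run]⟩
  | succ T ih =>
    have hhead : ∀ i, (a i).head.card ≤ N := fun i => by
      have := ha i
      generalize a i = b at this
      cases this with
      | output => simp [head]
      | round => assumption
    have hchild : ∀ i ans, Within N T ((a i).child ans) := fun i => by
      have := ha i
      generalize a i = b at this
      cases this with
      | output => exact fun _ => .output _ _
      | round => assumption
    have hsub : ∀ i, (a i).head ⊆ Finset.univ.biUnion fun i => (a i).head :=
      fun i => Finset.subset_biUnion_of_mem (fun i => (a i).head) (Finset.mem_univ i)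
    choose b hb hrun using fun
      ans : {q // q ∈ Finset.univ.biUnion fun i => (a i).head} → A =>
      ih (fun i => (a i).child fun q => ans ⟨q.1, hsub i q.2⟩) fun i => hchild i _
    refine ⟨round _ b, .round _ _ _ ?_ hb, fun oracle i => ?_⟩
    · exact Finset.card_biUnion_le_card_mul _ _ _ fun i _ => hhead i
    · simp only [run, hrun]
      exact run_child oracle (a i)

/-- If every query of an algorithm can be answered by an algorithm for another oracle, then so can
the whole algorithm be carried out with the other oracle. -/
theorem exists_simulate {N N' T R : ℕ} (sub : Q → ParallelAlg Q' A' A)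
    (hsub : ∀ q, Within N' R (sub q)) {a : ParallelAlg Q A O} (ha : Within N T a) :
    ∃ b : ParallelAlg Q' A' O, Within (N * N') (T * R) b ∧
      ∀ oracle, b.run oracle = a.run fun q => (sub q).run oracle := by
  induction ha with
  | output T x => exact ⟨output x, .output _ _, fun _ => rfl⟩
  | round T qs next hqs hnext ih =>
    choose b hb hrun using ih
    obtain ⟨p, hp, hprun⟩ := exists_parallel R (fun q : {q // q ∈ qs} => sub q.1)
      fun q => hsub q.1
    refine ⟨p.bind b, ?_, fun oracle => ?_⟩
    · rw [Nat.succ_mul, Nat.add_comm]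
      refine Within.bind (hp.mono (Nat.mul_le_mul_right _ ?_) le_rfl) hb
      simpa using hqs
    · simp only [run_bind, hrun, run]
      congr 2
      funext q
      exact hprun oracle q

/-- If algorithm `alg t` takes `T t` rounds, and for an unknown threshold `t₀ ≤ m` the algorithms
`alg t` with `t₀ ≤ t` are the ones that give an acceptable output, then an acceptable output can be
found in `O(T t₀)` rounds. -/
theorem exists_search (alg : ℕ → ParallelAlg Q A O) (T : ℕ → ℕ) (N m : ℕ) (accept : ℕ → O → Prop)
    (halg : ∀ t ≤ m, Within N (T t) (alg t)) :
    ∃ b : ParallelAlg Q A O, ∀ oracle, ∀ t₀ ≤ m,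
      (∀ t ≤ m, t₀ ≤ t → accept t ((alg t).run oracle)) →
      (∃ t ≤ m, accept t ((alg t).run oracle) ∧ b.run oracle = (alg t).run oracle) ∧
      b.maxQueries oracle ≤ N ∧ b.rounds oracle ≤ 4 * T t₀ + 1 := by
  classical
  -- The budget `2 ^ i` is spent on the largest guess that fits. If none fits, `findGreatest`
  -- returns 0, hence the second test of the budget in `attempt`.
  let pick : ℕ → ℕ := fun i => Nat.findGreatest (fun t => T t ≤ 2 ^ i) m
  let attempt : ℕ → ParallelAlg Q A O → ParallelAlg Q A O := fun i rest =>
    if T (pick i) ≤ 2 ^ i then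
      (alg (pick i)).bind fun x => if accept (pick i) x then output x else rest
    else rest
  let search : ℕ → ℕ → ParallelAlg Q A O := fun fuel =>
    Nat.rec (fun _ => alg 0) (fun _ rec i => attempt i (rec (i + 1))) fuel
  have hpick : ∀ i, pick i ≤ m := fun i => Nat.findGreatest_le m
  -- After `j` more doublings the budget covers `T t₀`; then the guess is at least `t₀` and is
  -- accepted. The budgets `2 ^ i, …, 2 ^ (i + j)` add up to `2 ^ (i + j + 1) - 2 ^ i`.
  have key : ∀ oracle, ∀ t₀ ≤ m, (∀ t ≤ m, t₀ ≤ t → accept t ((alg t).run oracle)) →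
      ∀ (j i fuel : ℕ), T t₀ ≤ 2 ^ (i + j) → j < fuel →
      (∃ t ≤ m, accept t ((alg t).run oracle) ∧
        (search fuel i).run oracle = (alg t).run oracle) ∧
      (search fuel i).maxQueries oracle ≤ N ∧
      (search fuel i).rounds oracle + 2 ^ i ≤ 2 ^ (i + j + 1) := by
    intro oracle t₀ ht₀ hacc j
    induction j with
    | zero =>
      intro i fuel hT hfuel
      obtain ⟨fuel, rfl⟩ : ∃ k, fuel = k + 1 := ⟨fuel - 1, by omega⟩
      have hP : T (pick i) ≤ 2 ^ i :=
        Nat.findGreatest_spec (P := fun t => T t ≤ 2 ^ i) ht₀ (by simpa using hT)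
      have hle : t₀ ≤ pick i := Nat.le_findGreatest ht₀ (by simpa using hT)
      have hA := hacc _ (hpick i) hle
      have hs : search (fuel + 1) i = (alg (pick i)).bind fun x =>
          if accept (pick i) x then output x else search fuel (i + 1) := by
        change attempt i _ = _
        simp only [attempt, if_pos hP]
        rfl
      rw [hs]
      refine ⟨⟨pick i, hpick i, hA, ?_⟩, ?_, ?_⟩
      · simp [run_bind, hA, run]
      · simpa [maxQueries_bind, hA, maxQueries] using (halg _ (hpick i)).maxQueries_le oracle
      · have := (halg _ (hpick i)).rounds_le oracle
        simp only [rounds_bind, hA, rounds, if_true, Nat.add_zero, pow_succ]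
        omega
    | succ j ih =>
      intro i fuel hT hfuel
      obtain ⟨fuel, rfl⟩ : ∃ k, fuel = k + 1 := ⟨fuel - 1, by omega⟩
      obtain ⟨h1, h2, h3⟩ := ih (i + 1) fuel (by convert hT using 2; omega) (by omega)
      have hpow : 2 ^ (i + (j + 1) + 1) = 2 ^ (i + 1 + j + 1) := by congr 1; omega
      have hi : 2 ^ (i + 1) = 2 * 2 ^ i := by ring
      by_cases hP : T (pick i) ≤ 2 ^ i
      · have hs : search (fuel + 1) i = (alg (pick i)).bind fun x =>
            if accept (pick i) x then output x else search fuel (i + 1) := by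
          change attempt i _ = _
          simp only [attempt, if_pos hP]
          rfl
        rw [hs]
        have hr := (halg _ (hpick i)).rounds_le oracle
        have hq := (halg _ (hpick i)).maxQueries_le oracle
        by_cases hA : accept (pick i) ((alg (pick i)).run oracle)
        · refine ⟨⟨pick i, hpick i, hA, ?_⟩, ?_, ?_⟩
          · simp [run_bind, hA, run]
          · simpa [maxQueries_bind, hA, maxQueries] using hq
          · simp only [rounds_bind, hA, rounds, if_true, Nat.add_zero]
            omega
        · simp only [run_bind, rounds_bind, maxQueries_bind, hA, if_false]
          exact ⟨h1, max_le hq h2, by omega⟩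
      · have hs : search (fuel + 1) i = search fuel (i + 1) := by
          change attempt i _ = _
          simp only [attempt, if_neg hP]
          rfl
        rw [hs]
        exact ⟨h1, h2, by omega⟩
  -- Fuel only: a bound on every `T t₀`, hence on the number of doublings, that does not depend on
  -- `t₀`.
  let S := ∑ t ∈ Finset.range (m + 1), T t
  refine ⟨search (S + 1) 0, fun oracle t₀ ht₀ hacc => ?_⟩
  have hS : T t₀ ≤ S := Finset.single_le_sum (f := T) (fun _ _ => Nat.zero_le _)
    (Finset.mem_range.2 (by omega))
  have hlog : T t₀ ≤ 2 ^ Nat.clog 2 (T t₀) := Nat.le_pow_clog (by norm_num) _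
  have hclog : Nat.clog 2 (T t₀) ≤ T t₀ :=
    (Nat.clog_le_iff_le_pow (by norm_num)).2 Nat.lt_two_pow_self.le
  obtain ⟨h1, h2, h3⟩ := key oracle t₀ ht₀ hacc (Nat.clog 2 (T t₀)) 0 (S + 1)
    (by simpa using hlog) (by omega)
  refine ⟨h1, h2, ?_⟩
  have : 2 ^ (0 + Nat.clog 2 (T t₀) + 1) ≤ 4 * T t₀ + 2 := by
    rcases Nat.lt_or_ge 1 (T t₀) with h | h
    · have := Nat.pow_pred_clog_lt_self (b := 2) (by norm_num) h
      have hpos := Nat.clog_pos (b := 2) (by norm_num) h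
      obtain ⟨c, hc⟩ : ∃ c, Nat.clog 2 (T t₀) = c + 1 := ⟨_, (Nat.sub_add_cancel hpos).symm⟩
      rw [hc] at this ⊢
      simp only [Nat.pred_eq_sub_one, Nat.add_sub_cancel] at this
      rw [Nat.zero_add, pow_succ, pow_succ]
      omega
    · rw [Nat.clog_of_right_le_one h]
      simp
  omega

end ParallelAlg

/-! ### Matroid preliminaries: truncation and simultaneous exchanges -/

namespace Matroid

variable {V : Type*}

theorem Indep.card_le_of_subset_closure {M : Matroid V} {I J : Finset V} (hI : M.Indep I)
    (h : (I : Set V) ⊆ M.closure J) : I.card ≤ J.card := by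
  have h1 := hI.encard_le_eRk_of_subset h
  rw [eRk_closure_eq] at h1
  simpa using h1.trans (M.eRk_le_encard _)

theorem insert_indep_iff_of_ground_eq_univ {M : Matroid V} (hE : M.E = Set.univ) {I : Set V}
    (hI : M.Indep I) {e : V} (he : e ∉ I) : M.Indep (insert e I) ↔ e ∉ M.closure I := by
  rw [hI.insert_indep_iff_of_notMem he, hE]
  simp

/-- The matroid whose independent sets are the independent sets of size at most `t`. -/
def truncateTo [Finite V] (M : Matroid V) (t : ℕ) : Matroid V :=
  (IndepMatroid.ofFinite (E := M.E) (Set.toFinite _) (fun I => M.Indep I ∧ I.ncard ≤ t)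
    ⟨M.empty_indep, by simp⟩
    (fun I J hJ hIJ => ⟨hJ.1.subset hIJ, (Set.ncard_le_ncard hIJ (Set.toFinite _)).trans hJ.2⟩)
    (fun I J hI hJ hlt => by
      obtain ⟨e, he, hi⟩ := hI.1.exists_insert_of_encard_lt hJ.1 (by
        rwa [← (Set.toFinite I).cast_ncard_eq, ← (Set.toFinite J).cast_ncard_eq, Nat.cast_lt])
      refine ⟨e, he.1, he.2, hi, ?_⟩
      rw [Set.ncard_insert_of_notMem he.2 (Set.toFinite _)]
      exact hlt.trans_le hJ.2)
    (fun I hI => hI.1.subset_ground)).matroid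

theorem truncateTo_indep [Finite V] {M : Matroid V} {t : ℕ} {I : Finset V} :
    (M.truncateTo t).Indep I ↔ M.Indep I ∧ I.card ≤ t := by
  change _ ∧ _ ↔ _
  simp

theorem truncateTo_eRk [Finite V] (M : Matroid V) (t : ℕ) (X : Finset V) :
    ((M.truncateTo t).eRk X).toNat = min (M.eRk X).toNat t := by
  classical
  obtain ⟨I, hI⟩ := M.exists_isBasis' (X : Set V)
  obtain ⟨J, hJ⟩ := (M.truncateTo t).exists_isBasis' (X : Set V)
  lift I to Finset V using Set.toFinite I
  lift J to Finset V using Set.toFinite J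
  rw [hJ.eRk_eq_encard, hI.eRk_eq_encard, Set.encard_coe_eq_coe_finsetCard,
    Set.encard_coe_eq_coe_finsetCard, ENat.toNat_natCast, ENat.toNat_natCast]
  obtain ⟨hJi, hJt⟩ := truncateTo_indep.1 hJ.indep
  apply le_antisymm
  · refine le_min ?_ hJt
    have := hJi.encard_le_eRk_of_subset hJ.subset
    rw [hI.eRk_eq_encard] at this
    simpa using this
  · obtain ⟨K, hKI, hK⟩ := Finset.exists_subset_card_eq (min_le_left I.card t)
    have hKi : (M.truncateTo t).Indep K := truncateTo_indep.2
      ⟨hI.indep.subset (by exact_mod_cast hKI), by omega⟩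
    have := hKi.encard_le_eRk_of_subset
      ((Finset.coe_subset.2 hKI).trans hI.subset)
    rw [hJ.eRk_eq_encard] at this
    rw [← hK]
    simpa using this

/-- A triangular family of exchanges can be carried out simultaneously. -/
theorem Indep.exchange {M : Matroid V} (hE : M.E = Set.univ) {I : Set V} (hI : M.Indep I)
    (u v : ℕ → V) (m : ℕ) (hu : ∀ i < m, u i ∈ I) (hv : ∀ i < m, v i ∉ I)
    (hyes : ∀ i < m, v i ∉ M.closure (I \ {u i}))
    (hno : ∀ i < m, ∀ j < i, v j ∈ M.closure (I \ {u i})) :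
    M.Indep ((I \ u '' Set.Iio m) ∪ v '' Set.Iio m) := by
  induction m with
  | zero => simpa using hI
  | succ m ih =>
    specialize ih (fun i hi => hu i (by omega)) (fun i hi => hv i (by omega))
      (fun i hi => hyes i (by omega)) (fun i hi => hno i (by omega))
    set T := (I \ u '' Set.Iio m) ∪ v '' Set.Iio m with hT
    -- Triangularity enters here: the elements brought in earlier do not enlarge the span of `I \ {u
    -- m}`, so the exchange of `u m` for `v m` is still possible.
    have hTsub : T \ {u m} ⊆ M.closure (I \ {u m}) := by
      rintro x ⟨hx | ⟨j, hj, rfl⟩, hxu⟩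
      · exact M.subset_closure _ (by simp [hE]) ⟨hx.1, hxu⟩
      · exact hno m (by omega) j hj
    have hvm : v m ∉ M.closure (T \ {u m}) := fun h =>
      hyes m (by omega) (M.closure_subset_closure_of_subset_closure hTsub h)
    have hTi : M.Indep (T \ {u m}) := ih.subset Set.sdiff_subset
    have hins := (insert_indep_iff_of_ground_eq_univ hE hTi
      (fun h => hvm (M.subset_closure _ (by simp [hE]) h))).2 hvm
    refine hins.subset ?_
    have hne : ∀ i < m + 1, v i ≠ u m := fun i hi h => hv i hi (h ▸ hu m (by omega))
    have hmem : ∀ w : ℕ → V, w '' Set.Iio (m + 1) = insert (w m) (w '' Set.Iio m) := fun w => by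
      rw [← Order.succ_eq_add_one, Order.Iio_succ_eq_insert, Set.image_insert_eq]
    rintro x (⟨hx, hxu⟩ | hx)
    · rw [hmem, Set.mem_insert_iff, not_or] at hxu
      exact Or.inr ⟨Or.inl ⟨hx, hxu.2⟩, hxu.1⟩
    · rw [hmem] at hx
      rcases hx with rfl | hx
      · exact Or.inl rfl
      · refine Or.inr ⟨Or.inr hx, ?_⟩
        obtain ⟨j, hj, rfl⟩ := hx
        exact hne j (Nat.lt_succ_of_lt hj)

/-- A triangular family of exchanges together with an element outside the span. -/
theorem Indep.exchange_insert {M : Matroid V} (hE : M.E = Set.univ) {I : Set V} (hI : M.Indep I)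
    (u v : ℕ → V) (w : V) (m : ℕ) (hu : ∀ i < m, u i ∈ I) (hv : ∀ i < m, v i ∉ I)
    (hyes : ∀ i < m, v i ∉ M.closure (I \ {u i}))
    (hno : ∀ i < m, ∀ j < i, v j ∈ M.closure (I \ {u i}))
    (hspan : ∀ i < m, v i ∈ M.closure I) (hw : w ∉ M.closure I) :
    M.Indep (insert w ((I \ u '' Set.Iio m) ∪ v '' Set.Iio m)) := by
  have hsub : (I \ u '' Set.Iio m) ∪ v '' Set.Iio m ⊆ M.closure I := by
    rintro x (hx | ⟨i, hi, rfl⟩)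
    · exact M.subset_closure _ (by simp [hE]) hx.1
    · exact hspan i hi
  have hw' : w ∉ M.closure ((I \ u '' Set.Iio m) ∪ v '' Set.Iio m) := fun h =>
    hw (M.closure_subset_closure_of_subset_closure hsub h)
  exact (insert_indep_iff_of_ground_eq_univ hE (hI.exchange hE u v m hu hv hyes hno)
    fun h => hw' (M.subset_closure _ (by simp [hE]) h)).2 hw'

/-- For subsets of an independent set, closure commutes with intersection, so deletions that are
harmless one at a time are harmless together. -/
theorem Indep.mem_closure_sdiff {M : Matroid V} {I : Set V} (hI : M.Indep I) {x : V}
    (hx : x ∈ M.closure I) (F : Finset V) (h : ∀ u ∈ F, x ∈ M.closure (I \ {u})) :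
    x ∈ M.closure (I \ F) := by
  classical
  induction F using Finset.induction_on with
  | empty => simpa using hx
  | insert a F ha ih =>
    have h1 := ih fun u hu => h u (Finset.mem_insert_of_mem hu)
    have h2 := h a (Finset.mem_insert_self _ _)
    have := (hI.subset (Set.union_subset Set.sdiff_subset Set.sdiff_subset :
      (I \ F) ∪ (I \ {a}) ⊆ I)).closure_inter_eq_inter_closure
    have hx : x ∈ M.closure ((I \ ↑F) ∩ (I \ {a})) := this ▸ ⟨h1, h2⟩
    refine M.closure_mono ?_ hx
    rintro y ⟨⟨hy, hyF⟩, -, hya⟩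
    exact ⟨hy, by simpa using ⟨hya, hyF⟩⟩

end Matroid

/-! ### The duality certificate and the exchange graph -/

namespace MatroidIntersection

variable {V : Type*}

/-- Edmonds' certificate: outside `U` compare `T` with `S` in the first matroid, inside `U` in the
second, and add the two inequalities. -/
theorem isMaxCommonIndep_of_closure {M₁ M₂ : Matroid V} {S : Finset V}
    (hS : IsCommonIndep M₁ M₂ S) (U : Set V)
    (h₁ : Uᶜ ⊆ M₁.closure (S \ U)) (h₂ : U ⊆ M₂.closure (S ∩ U)) : IsMaxCommonIndep M₁ M₂ S := by
  classical
  refine ⟨hS, fun T hT => ?_⟩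
  have e1 := (hT.1.subset (Finset.coe_subset.2 (Finset.filter_subset (· ∉ U) T))
    ).card_le_of_subset_closure (J := S.filter (· ∉ U)) fun x hx => by
      have : x ∈ Uᶜ := (Finset.mem_filter.1 (Finset.mem_coe.1 hx)).2
      convert h₁ this using 2
      ext; simp
  have e2 := (hT.2.subset (Finset.coe_subset.2 (Finset.filter_subset (· ∈ U) T))
    ).card_le_of_subset_closure (J := S.filter (· ∈ U)) fun x hx => by
      have : x ∈ U := (Finset.mem_filter.1 (Finset.mem_coe.1 hx)).2
      convert h₂ this using 2
      ext; simp
  have f1 := Finset.card_filter_add_card_filter_not (s := T) (· ∈ U)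
  have f2 := Finset.card_filter_add_card_filter_not (s := S) (· ∈ U)
  omega

section Augmentation

variable [DecidableEq V]

/-- Arcs of the exchange graph of `S`, as seen through the answers `f` to independence queries. -/
def Arc (f : Query V → Bool) (S : Finset V) (x y : V) : Prop :=
  (x ∉ S ∧ y ∈ S ∧ f (1, insert x (S.erase y)) = true) ∨
    (x ∈ S ∧ y ∉ S ∧ f (0, insert y (S.erase x)) = true)

/-- The sources (`i = 0`) and sinks (`i = 1`) of the exchange graph. -/
def Terminal (f : Query V → Bool) (S : Finset V) (i : Fin 2) (x : V) : Prop :=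
  x ∉ S ∧ f (i, insert x S) = true

/-- Walks of length `n` in the exchange graph that start in a source. -/
def SourceWalk (f : Query V → Bool) (S : Finset V) (n : ℕ) (p : ℕ → V) : Prop :=
  Terminal f S 0 (p 0) ∧ ∀ i < n, Arc f S (p i) (p (i + 1))

/-- There is an augmenting path of length `n`. -/
def HasAugPath (f : Query V → Bool) (S : Finset V) (n : ℕ) : Prop :=
  ∃ p, SourceWalk f S n p ∧ Terminal f S 1 (p n)

open Classical in
/-- Augment `S` along a shortest augmenting path. -/
noncomputable def augment (f : Query V → Bool) (S : Finset V) : Finset V :=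
  if h : ∃ n, HasAugPath f S n then
    symmDiff S ((Finset.range (Nat.find h + 1)).image (Nat.find_spec h).choose)
  else S

/-- The independence queries that determine the exchange graph of `S`. -/
def augmentQueries [Fintype V] (S : Finset V) : Finset (Query V) :=
  (Finset.univ.image fun q : Fin 2 × V => (q.1, insert q.2 S)) ∪
    Finset.univ.image fun q : Fin 2 × V × V => (q.1, insert q.2.1 (S.erase q.2.2))

theorem card_augmentQueries_le [Fintype V] (S : Finset V) :
    (augmentQueries S).card ≤ 2 * Fintype.card V + 2 * Fintype.card V ^ 2 := by
  refine (Finset.card_union_le _ _).trans (Nat.add_le_add ?_ ?_)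
  · exact Finset.card_image_le.trans (by simp)
  · exact Finset.card_image_le.trans (by simp [sq])

theorem SourceWalk.splice {f : Query V → Bool} {S : Finset V} {n : ℕ} {p : ℕ → V}
    (hp : SourceWalk f S n p) {i d : ℕ} (hid : i + 1 + d ≤ n)
    (harc : Arc f S (p i) (p (i + 1 + d))) :
    SourceWalk f S (n - d) fun k => if k ≤ i then p k else p (k + d) := by
  refine ⟨by simpa using hp.1, fun k hk => ?_⟩
  dsimp only
  rcases lt_trichotomy k i with h | rfl | h
  · rw [if_pos h.le, if_pos (by omega)]
    exact hp.2 k (by omega)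
  · rw [if_pos le_rfl, if_neg (by omega)]
    exact harc
  · rw [if_neg (by omega), if_neg (by omega), Nat.add_right_comm]
    exact hp.2 (k + d) (by omega)

theorem SourceWalk.snoc {f : Query V → Bool} {S : Finset V} {n : ℕ} {p : ℕ → V} {y : V}
    (hp : SourceWalk f S n p) (h : Arc f S (p n) y) :
    SourceWalk f S (n + 1) fun k => if k ≤ n then p k else y := by
  refine ⟨by simpa using hp.1, fun k hk => ?_⟩
  dsimp only
  rcases Nat.lt_succ_iff_lt_or_eq.1 hk with h' | rfl
  · rw [if_pos h'.le, if_pos (by omega)]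
    exact hp.2 k h'
  · rw [if_pos le_rfl, if_neg (by omega)]
    exact h

theorem SourceWalk.mem_iff {f : Query V → Bool} {S : Finset V} {n : ℕ} {p : ℕ → V}
    (hp : SourceWalk f S n p) {i : ℕ} (hi : i ≤ n) : p i ∈ S ↔ i % 2 = 1 := by
  induction i with
  | zero => simpa using hp.1.1
  | succ i ih =>
    specialize ih (by omega)
    rcases hp.2 i (by omega) with ⟨h1, h2, -⟩ | ⟨h1, h2, -⟩
    · have : i % 2 ≠ 1 := fun h => h1 (ih.2 h)
      simp only [h2, true_iff]
      omega
    · have := ih.1 h1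
      simp only [h2, false_iff]
      omega

/-- A shortest augmenting path has no shortcuts. -/
structure IsShortest (f : Query V → Bool) (S : Finset V) (n : ℕ) (p : ℕ → V) : Prop where
  walk : SourceWalk f S n p
  sink : Terminal f S 1 (p n)
  not_source : ∀ i ≤ n, 0 < i → ¬ Terminal f S 0 (p i)
  not_sink : ∀ i < n, ¬ Terminal f S 1 (p i)
  not_arc : ∀ i j, i + 1 < j → j ≤ n → ¬ Arc f S (p i) (p j)
  inj : ∀ i j, i < j → j ≤ n → p i ≠ p j

/-- Every violation yields a shorter augmenting path: start at the later source, stop at the earlier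
sink, or splice along the long arc. A repeated vertex `p i = p j` is a later source if `i = 0`, and
otherwise makes `p (i - 1)`, `p j` a long arc. -/
theorem isShortest_of_forall_lt {f : Query V → Bool} {S : Finset V} {n : ℕ} {p : ℕ → V}
    (hp : SourceWalk f S n p) (hsink : Terminal f S 1 (p n))
    (hmin : ∀ m < n, ¬ HasAugPath f S m) : IsShortest f S n p := by
  have hsource : ∀ i ≤ n, 0 < i → ¬ Terminal f S 0 (p i) := fun i hi hpos h => by
    refine hmin (n - i) (by omega) ⟨fun k => p (k + i), ⟨by simpa using h, fun k hk => ?_⟩, ?_⟩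
    · have := hp.2 (k + i) (by omega)
      rwa [Nat.add_right_comm] at this
    · simpa [Nat.sub_add_cancel hi] using hsink
  have hs : ∀ i < n, ¬ Terminal f S 1 (p i) := fun i hi h =>
    hmin i hi ⟨p, ⟨hp.1, fun k hk => hp.2 k (by omega)⟩, h⟩
  have harc : ∀ i j, i + 1 < j → j ≤ n → ¬ Arc f S (p i) (p j) := fun i j hij hj h => by
    obtain ⟨d, rfl⟩ : ∃ d, j = i + 1 + d := ⟨j - (i + 1), by omega⟩
    refine hmin (n - d) (by omega) ⟨_, hp.splice hj h, ?_⟩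
    rw [if_neg (by omega), Nat.sub_add_cancel (by omega)]
    exact hsink
  refine ⟨hp, hsink, hsource, hs, harc, fun i j hij hj h => ?_⟩
  rcases Nat.eq_zero_or_pos i with rfl | hi
  · exact hsource j hj hij (h ▸ hp.1)
  · have := hp.2 (i - 1) (by omega)
    rw [Nat.sub_add_cancel hi, h] at this
    exact harc (i - 1) j (by omega) hj this

end Augmentation

end MatroidIntersection

/-! ### Augmentation along shortest paths -/

namespace MatroidIntersection

variable {V : Type*}

theorem indepOracle_eq_true_iff {M₁ M₂ : Matroid V} {i : Fin 2} {X : Finset V} :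
    indepOracle M₁ M₂ (i, X) = true ↔ (![M₁, M₂] i).Indep X := by
  simp [indepOracle]

section Augmentation

variable [DecidableEq V]

/-- A walk alternates between the complement of `S` and `S`. It starts and ends outside, so its
length is even; the odd vertices leave `S` and the even ones enter. -/
theorem IsShortest.exists_symmDiff_eq {f : Query V → Bool} {S : Finset V} {n : ℕ} {p : ℕ → V}
    (h : IsShortest f S n p) : ∃ m, n = 2 * m ∧
      symmDiff S ((Finset.range (n + 1)).image p) =
        (S \ (Finset.range m).image fun i => p (2 * i + 1)) ∪
          (Finset.range (m + 1)).image fun i => p (2 * i) := by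
  have hn : n % 2 ≠ 1 := fun hn => h.sink.1 ((h.walk.mem_iff le_rfl).2 hn)
  obtain ⟨m, rfl⟩ : ∃ m, n = 2 * m := ⟨n / 2, by omega⟩
  refine ⟨m, rfl, ?_⟩
  have hP : ∀ x, x ∈ (Finset.range (2 * m + 1)).image p ↔
      x ∈ (Finset.range m).image (fun i => p (2 * i + 1)) ∨
        x ∈ (Finset.range (m + 1)).image fun i => p (2 * i) := fun x => by
    simp only [Finset.mem_image, Finset.mem_range]
    constructor
    · rintro ⟨i, hi, rfl⟩
      rcases Nat.even_or_odd' i with ⟨c, rfl | rfl⟩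
      · exact Or.inr ⟨c, by omega, rfl⟩
      · exact Or.inl ⟨c, by omega, rfl⟩
    · rintro (⟨i, hi, rfl⟩ | ⟨i, hi, rfl⟩)
      · exact ⟨_, by omega, rfl⟩
      · exact ⟨_, by omega, rfl⟩
  have hU : ∀ x ∈ (Finset.range m).image (fun i => p (2 * i + 1)), x ∈ S := fun x hx => by
    simp only [Finset.mem_image, Finset.mem_range] at hx
    obtain ⟨i, hi, rfl⟩ := hx
    exact (h.walk.mem_iff (by omega)).2 (by omega)
  have hW : ∀ x ∈ (Finset.range (m + 1)).image (fun i => p (2 * i)), x ∉ S := fun x hx => by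
    simp only [Finset.mem_image, Finset.mem_range] at hx
    obtain ⟨i, hi, rfl⟩ := hx
    rw [h.walk.mem_iff (by omega)]
    omega
  ext x
  have h1 := hP x
  have h2 := hU x
  have h3 := hW x
  rw [Finset.mem_symmDiff, Finset.mem_union, Finset.mem_sdiff, h1]
  tauto

theorem IsShortest.card_symmDiff {f : Query V → Bool} {S : Finset V} {n : ℕ} {p : ℕ → V}
    (h : IsShortest f S n p) :
    (symmDiff S ((Finset.range (n + 1)).image p)).card = S.card + 1 := by
  obtain ⟨m, rfl, heq⟩ := h.exists_symmDiff_eq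
  have hinj : ∀ i j, i ≤ 2 * m → j ≤ 2 * m → p i = p j → i = j := fun i j hi hj hij => by
    rcases lt_trichotomy i j with hlt | rfl | hlt
    · exact (h.inj i j hlt hj hij).elim
    · rfl
    · exact (h.inj j i hlt hi hij.symm).elim
  have hU : (Finset.range m).image (fun i => p (2 * i + 1)) ⊆ S := fun x hx => by
    simp only [Finset.mem_image, Finset.mem_range] at hx
    obtain ⟨i, hi, rfl⟩ := hx
    exact (h.walk.mem_iff (by omega)).2 (by omega)
  rw [heq, Finset.card_union_of_disjoint, Finset.card_sdiff_of_subset hU,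
    Finset.card_image_of_injOn, Finset.card_image_of_injOn, Finset.card_range, Finset.card_range]
  · have := Finset.card_le_card hU
    rw [Finset.card_image_of_injOn, Finset.card_range] at this
    · omega
    · intro i hi j hj hij
      simp only [Finset.coe_range, Set.mem_Iio] at hi hj
      have := hinj _ _ (by omega) (by omega) hij
      omega
  · intro i hi j hj hij
    simp only [Finset.coe_range, Set.mem_Iio] at hi hj
    have := hinj _ _ (by omega) (by omega) hij
    omega
  · intro i hi j hj hij
    simp only [Finset.coe_range, Set.mem_Iio] at hi hj
    have := hinj _ _ (by omega) (by omega) hij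
    omega
  · rw [Finset.disjoint_left]
    intro x hx hx'
    simp only [Finset.mem_image, Finset.mem_range] at hx'
    obtain ⟨i, hi, rfl⟩ := hx'
    have := (h.walk.mem_iff (i := 2 * i) (by omega)).1 (Finset.mem_sdiff.1 hx).1
    omega

variable [Fintype V] {M₁ M₂ : Matroid V} {S : Finset V} {f : Query V → Bool}

theorem terminal_iff (hE : ∀ i, (![M₁, M₂] i).E = Set.univ) (hS : IsCommonIndep M₁ M₂ S)
    (hf : ∀ q ∈ augmentQueries S, f q = indepOracle M₁ M₂ q) (i : Fin 2) (x : V) :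
    Terminal f S i x ↔ x ∉ S ∧ x ∉ (![M₁, M₂] i).closure S := by
  refine and_congr_right fun hx => ?_
  have hSi : (![M₁, M₂] i).Indep S := by
    fin_cases i
    exacts [hS.1, hS.2]
  rw [hf _ (Finset.mem_union_left _ (Finset.mem_image.2 ⟨(i, x), Finset.mem_univ _, rfl⟩)),
    indepOracle_eq_true_iff, Finset.coe_insert,
    Matroid.insert_indep_iff_of_ground_eq_univ (hE i) hSi (by simpa using hx)]

theorem exchange_query_iff (hE : ∀ i, (![M₁, M₂] i).E = Set.univ) (hS : IsCommonIndep M₁ M₂ S)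
    (hf : ∀ q ∈ augmentQueries S, f q = indepOracle M₁ M₂ q) (i : Fin 2) {x y : V} (hx : x ∉ S) :
    f (i, insert x (S.erase y)) = true ↔ x ∉ (![M₁, M₂] i).closure (S \ {y}) := by
  have hSi : (![M₁, M₂] i).Indep S := by
    fin_cases i
    exacts [hS.1, hS.2]
  rw [hf _ (Finset.mem_union_right _ (Finset.mem_image.2 ⟨(i, x, y), Finset.mem_univ _, rfl⟩)),
    indepOracle_eq_true_iff, Finset.coe_insert, Finset.coe_erase,
    Matroid.insert_indep_iff_of_ground_eq_univ (hE i) (hSi.subset Set.sdiff_subset)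
      (fun h => hx h.1)]

theorem arc_iff_of_notMem (hE : ∀ i, (![M₁, M₂] i).E = Set.univ) (hS : IsCommonIndep M₁ M₂ S)
    (hf : ∀ q ∈ augmentQueries S, f q = indepOracle M₁ M₂ q) {x y : V} (hx : x ∉ S) (hy : y ∈ S) :
    Arc f S x y ↔ x ∉ M₂.closure (S \ {y}) := by
  simp only [Arc, exchange_query_iff hE hS hf 1 hx, hx, hy, not_false_eq_true, true_and, false_and,
    or_false]
  rfl

theorem arc_iff_of_mem (hE : ∀ i, (![M₁, M₂] i).E = Set.univ) (hS : IsCommonIndep M₁ M₂ S)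
    (hf : ∀ q ∈ augmentQueries S, f q = indepOracle M₁ M₂ q) {x y : V} (hx : x ∈ S) (hy : y ∉ S) :
    Arc f S x y ↔ y ∉ M₁.closure (S \ {x}) := by
  simp only [Arc, exchange_query_iff hE hS hf 0 hy, hx, hy, not_false_eq_true, true_and, false_and,
    not_true_eq_false, false_or]
  rfl

/-- The absence of shortcuts is exactly the triangularity needed in `Indep.exchange_insert`. The
first matroid pairs each odd vertex with its successor and has the source left over; the second
pairs it with its predecessor and has the sink left over. -/
theorem IsShortest.isCommonIndep (hE : ∀ i, (![M₁, M₂] i).E = Set.univ)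
    (hS : IsCommonIndep M₁ M₂ S) (hf : ∀ q ∈ augmentQueries S, f q = indepOracle M₁ M₂ q)
    {n : ℕ} {p : ℕ → V} (h : IsShortest f S n p) :
    IsCommonIndep M₁ M₂ (symmDiff S ((Finset.range (n + 1)).image p)) := by
  obtain ⟨m, rfl, heq⟩ := h.exists_symmDiff_eq
  have hodd : ∀ i < m, p (2 * i + 1) ∈ S := fun i hi =>
    (h.walk.mem_iff (by omega)).2 (by omega)
  have heven : ∀ i ≤ m, p (2 * i) ∉ S := fun i hi => by
    rw [h.walk.mem_iff (by omega)]
    omega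
  have ht := terminal_iff hE hS hf
  rw [heq]
  constructor
  -- Shortcuts are excluded only forward along the path, so in the first matroid the triangular
  -- order runs backward from the sink.
  · have key := hS.1.exchange_insert (hE 0) (fun i => p (2 * (m - 1 - i) + 1))
      (fun i => p (2 * (m - i))) (p (2 * 0)) m (fun i hi => hodd _ (by omega))
      (fun i hi => heven _ (by omega)) (fun i hi => ?_) (fun i hi j hj => ?_) (fun i hi => ?_)
      ((ht 0 _).1 h.walk.1).2
    · refine key.subset ?_
      intro x hx
      simp only [Finset.coe_union, Finset.coe_sdiff, Finset.coe_image, Finset.coe_range] at hx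
      rcases hx with ⟨hx, hx'⟩ | ⟨i, hi, rfl⟩
      · refine Or.inr (Or.inl ⟨hx, ?_⟩)
        rintro ⟨i, hi, rfl⟩
        exact hx' ⟨m - 1 - i, by simp at hi ⊢; omega, rfl⟩
      · rcases Nat.eq_zero_or_pos i with rfl | hpos
        · exact Or.inl rfl
        · simp only [Set.mem_Iio] at hi
          refine Or.inr (Or.inr ⟨m - i, by simp; omega, ?_⟩)
          simp only
          congr 2
          omega
    · have harc := h.walk.2 (2 * (m - 1 - i) + 1) (by omega)
      rw [show 2 * (m - 1 - i) + 1 + 1 = 2 * (m - i) by omega] at harc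
      exact (arc_iff_of_mem hE hS hf (hodd _ (by omega)) (heven _ (by omega))).1 harc
    · by_contra hcon
      exact h.not_arc (2 * (m - 1 - i) + 1) (2 * (m - j)) (by omega) (by omega)
        ((arc_iff_of_mem hE hS hf (hodd _ (by omega)) (heven _ (by omega))).2 hcon)
    · by_contra hcon
      exact h.not_source (2 * (m - i)) (by omega) (by omega)
        ((ht 0 _).2 ⟨heven _ (by omega), hcon⟩)
  · have key := hS.2.exchange_insert (hE 1) (fun i => p (2 * i + 1))
      (fun i => p (2 * i)) (p (2 * m)) m (fun i hi => hodd _ (by omega))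
      (fun i hi => heven _ (by omega)) (fun i hi => ?_) (fun i hi j hj => ?_) (fun i hi => ?_)
      ((ht 1 _).1 h.sink).2
    · refine key.subset ?_
      intro x hx
      simp only [Finset.coe_union, Finset.coe_sdiff, Finset.coe_image, Finset.coe_range] at hx
      rcases hx with hx | ⟨i, hi, rfl⟩
      · exact Or.inr (Or.inl hx)
      · rcases Nat.lt_succ_iff_lt_or_eq.1 hi with hi | rfl
        · exact Or.inr (Or.inr ⟨i, hi, rfl⟩)
        · exact Or.inl rfl
    · exact (arc_iff_of_notMem hE hS hf (heven _ (by omega)) (hodd _ (by omega))).1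
        (h.walk.2 (2 * i) (by omega))
    · by_contra hcon
      exact h.not_arc (2 * j) (2 * i + 1) (by omega) (by omega)
        ((arc_iff_of_notMem hE hS hf (heven _ (by omega)) (hodd _ (by omega))).2 hcon)
    · by_contra hcon
      exact h.not_sink (2 * i) (by omega) ((ht 1 _).2 ⟨heven _ (by omega), hcon⟩)

/-- The certificate `U` is the set of vertices reachable from sources. A `v ∉ S` outside `U` is no
source and receives no arc from `S ∩ U`; inside `U` it is no sink and sends no arc to `S \ U`. So
the elements of `S` on the wrong side can be deleted without losing `v` from the span. -/
theorem isMaxCommonIndep_of_not_hasAugPath (hE : ∀ i, (![M₁, M₂] i).E = Set.univ)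
    (hS : IsCommonIndep M₁ M₂ S) (hf : ∀ q ∈ augmentQueries S, f q = indepOracle M₁ M₂ q)
    (h : ¬ ∃ n, HasAugPath f S n) : IsMaxCommonIndep M₁ M₂ S := by
  classical
  let U : Set V := {x | ∃ n p, SourceWalk f S n p ∧ p n = x}
  have hclosed : ∀ x ∈ U, ∀ y, Arc f S x y → y ∈ U := by
    rintro _ ⟨n, p, hp, rfl⟩ y hxy
    exact ⟨n + 1, _, hp.snoc hxy, by simp⟩
  have ht := terminal_iff hE hS hf
  have hsrc : ∀ x, Terminal f S 0 x → x ∈ U := fun x hx =>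
    ⟨0, fun _ => x, ⟨hx, by simp⟩, rfl⟩
  refine isMaxCommonIndep_of_closure hS U (fun v hv => ?_) fun v hv => ?_
  · by_cases hvS : v ∈ S
    · exact M₁.subset_closure _ (by simp [show M₁.E = _ from hE 0]) ⟨hvS, hv⟩
    · have hvc : v ∈ M₁.closure S := by
        by_contra hcon
        exact hv (hsrc v ((ht 0 v).2 ⟨hvS, hcon⟩))
      have := hS.1.mem_closure_sdiff hvc (S.filter (· ∈ U)) fun u hu => by
        rw [Finset.mem_filter] at hu
        by_contra hcon
        exact hv (hclosed u hu.2 v ((arc_iff_of_mem hE hS hf hu.1 hvS).2 hcon))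
      convert this using 2
      ext x
      simp
      tauto
  · by_cases hvS : v ∈ S
    · exact M₂.subset_closure _ (by simp [show M₂.E = _ from hE 1]) ⟨hvS, hv⟩
    · have hvc : v ∈ M₂.closure S := by
        by_contra hcon
        obtain ⟨n, p, hp, rfl⟩ := hv
        exact h ⟨n, p, hp, (ht 1 _).2 ⟨hvS, hcon⟩⟩
      have := hS.2.mem_closure_sdiff hvc (S.filter (· ∉ U)) fun u hu => by
        rw [Finset.mem_filter] at hu
        by_contra hcon
        exact hu.2 (hclosed v hv u ((arc_iff_of_notMem hE hS hf hvS hu.1).2 hcon))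
      convert this using 2
      ext x
      simp
      tauto

theorem augment_spec (hE : ∀ i, (![M₁, M₂] i).E = Set.univ)
    (hS : IsCommonIndep M₁ M₂ S) (hf : ∀ q ∈ augmentQueries S, f q = indepOracle M₁ M₂ q) :
    IsCommonIndep M₁ M₂ (augment f S) ∧
      ((augment f S).card = S.card + 1 ∨ IsMaxCommonIndep M₁ M₂ (augment f S)) := by
  classical
  by_cases h : ∃ n, HasAugPath f S n
  · have hspec := (Nat.find_spec h).choose_spec
    have hshort := isShortest_of_forall_lt hspec.1 hspec.2 fun m hm => Nat.find_min h hm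
    rw [augment, dif_pos h]
    exact ⟨hshort.isCommonIndep hE hS hf, Or.inl hshort.card_symmDiff⟩
  · rw [augment, dif_neg h]
    exact ⟨hS, Or.inr (isMaxCommonIndep_of_not_hasAugPath hE hS hf h)⟩

end Augmentation

end MatroidIntersection

/-! ### Greedy bases from ranks of prefixes -/

namespace MatroidIntersection

variable {V : Type*} [Fintype V]

section Greedy

/-- An injective refinement of `f`. -/
noncomputable def key (f : V → ℕ) (v : V) : ℕ := f v * Fintype.card V + Fintype.equivFin V v

theorem key_injective (f : V → ℕ) : Function.Injective (key f) := fun u v h => by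
  have hu := (Fintype.equivFin V u).2
  have hv := (Fintype.equivFin V v).2
  have := congrArg (· % Fintype.card V) h
  simp only [key, Nat.add_mod, Nat.mul_mod_left, Nat.zero_add,
    Nat.mod_eq_of_lt hu, Nat.mod_eq_of_lt hv] at this
  exact (Fintype.equivFin V).injective (Fin.ext this)

theorem key_lt_iff {f : V → ℕ} {v : V} {j : ℕ} : key f v < j * Fintype.card V ↔ f v < j := by
  have hv := (Fintype.equivFin V v).2
  constructor
  · intro h
    by_contra hcon
    have := Nat.mul_le_mul_right (Fintype.card V) (not_lt.1 hcon)
    rw [key] at h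
    omega
  · intro h
    have := Nat.mul_le_mul_right (Fintype.card V) (Nat.succ_le_of_lt h)
    rw [Nat.succ_mul] at this
    rw [key]
    omega

theorem key_lt_key {f : V → ℕ} {u v : V} (h : f u < f v) : key f u < key f v := by
  have := key_lt_iff.2 h
  have h' : f v * Fintype.card V ≤ key f v := Nat.le_add_right _ _
  omega

theorem le_of_key_lt_key {f : V → ℕ} {u v : V} (h : key f u < key f v) : f u ≤ f v := by
  by_contra hcon
  exact (key_lt_key (not_le.1 hcon)).not_gt h

open Classical in
/-- The elements that come before `v` in the order refining `f`. -/
noncomputable def before (f : V → ℕ) (v : V) : Finset V :=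
  Finset.univ.filter fun u => key f u < key f v

theorem mem_before {f : V → ℕ} {u v : V} : u ∈ before f v ↔ key f u < key f v := by
  simp [before]

open Classical in
/-- The greedy basis with respect to the order refining `f`, computed with the rank function `r`. -/
noncomputable def greedy (r : Finset V → ℕ) (f : V → ℕ) : Finset V :=
  Finset.univ.filter fun v => r (before f v) < r (insert v (before f v))

omit [Fintype V] in
theorem eRk_toNat_lt_insert_iff [Finite V] [DecidableEq V] {M : Matroid V} (hE : M.E = Set.univ)
    {X : Finset V} {v : V} :
    (M.eRk X).toNat < (M.eRk (insert v X : Finset V)).toNat ↔ v ∉ M.closure X := by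
  rw [Finset.coe_insert]
  constructor
  · intro h hv
    rw [← M.eRk_insert_closure_eq, Set.insert_eq_of_mem hv, M.eRk_closure_eq] at h
    exact lt_irrefl _ h
  · intro hv
    rw [M.eRk_insert_eq_add_one ⟨by simp [hE], hv⟩]
    have hfin : M.eRk X ≠ ⊤ := ne_top_of_le_ne_top (by simp) (M.eRk_le_encard X)
    lift M.eRk X to ℕ using hfin with m
    rw [← Nat.cast_one, ← Nat.cast_add, ENat.toNat_natCast, ENat.toNat_natCast]
    omega

theorem mem_greedy {M : Matroid V} (hE : M.E = Set.univ) {f : V → ℕ} {v : V} :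
    v ∈ greedy (fun X => (M.eRk X).toNat) f ↔ v ∉ M.closure (before f v) := by
  classical
  rw [greedy, Finset.mem_filter, ← eRk_toNat_lt_insert_iff hE]
  simp only [Finset.mem_univ, true_and]

/-- A prefix of the order and its greedy part have the same closure, so comparing the ranks of full
prefixes, which needs no earlier greedy choice, amounts to the sequential greedy test. -/
theorem greedy_aux {M : Matroid V} (hE : M.E = Set.univ) (f : V → ℕ) (x : ℕ) :
    M.Indep ({v | v ∈ greedy (fun X => (M.eRk X).toNat) f ∧ key f v < x}) ∧
      {v | key f v < x} ⊆
        M.closure {v | v ∈ greedy (fun X => (M.eRk X).toNat) f ∧ key f v < x} := by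
  induction x with
  | zero => simp
  | succ x ih =>
    set G := greedy (fun X => (M.eRk X).toNat) f
    by_cases hx : ∃ v, key f v = x
    · obtain ⟨v, rfl⟩ := hx
      have hlt : ∀ u, key f u < key f v + 1 ↔ u = v ∨ key f u < key f v := fun u => by
        rw [Nat.lt_succ_iff_lt_or_eq, or_comm, (key_injective f).eq_iff]
      have hbefore : {u | key f u < key f v} = (before f v : Set V) := by
        ext u
        simp [mem_before]
      have hcl : M.closure {u | u ∈ G ∧ key f u < key f v} = M.closure (before f v) := by
        apply le_antisymm
        · exact M.closure_mono (by rw [← hbefore]; exact fun u hu => hu.2)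
        · rw [← hbefore]
          exact M.closure_subset_closure_of_subset_closure ih.2
      by_cases hv : v ∈ G
      · have heq : {u | u ∈ G ∧ key f u < key f v + 1} =
            insert v {u | u ∈ G ∧ key f u < key f v} := by
          ext u
          simp only [hlt, Set.mem_ofPred_eq, Set.mem_insert_iff]
          constructor
          · rintro ⟨h1, h2 | h2⟩ <;> tauto
          · rintro (rfl | h) <;> tauto
        rw [heq]
        refine ⟨(Matroid.insert_indep_iff_of_ground_eq_univ hE ih.1 (by simp)).2 ?_, ?_⟩
        · rw [hcl]
          exact (mem_greedy hE).1 hv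
        · intro u hu
          rcases (hlt u).1 hu with rfl | hu
          · exact M.subset_closure _ (by simp [hE]) (Set.mem_insert _ _)
          · exact M.closure_mono (Set.subset_insert _ _) (ih.2 hu)
      · have heq : {u | u ∈ G ∧ key f u < key f v + 1} = {u | u ∈ G ∧ key f u < key f v} := by
          ext u
          simp only [hlt, Set.mem_ofPred_eq]
          constructor
          · rintro ⟨h1, rfl | h2⟩ <;> tauto
          · tauto
        rw [heq]
        refine ⟨ih.1, fun u hu => ?_⟩
        rcases (hlt u).1 hu with rfl | hu
        · rw [hcl]
          by_contra hcon
          exact hv ((mem_greedy hE).2 hcon)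
        · exact ih.2 hu
    · have hlt : ∀ u, key f u < x + 1 ↔ key f u < x := fun u => by
        have : key f u ≠ x := fun h => hx ⟨u, h⟩
        omega
      simpa only [hlt] using ih

theorem greedy_indep {M : Matroid V} (hE : M.E = Set.univ) (f : V → ℕ) :
    M.Indep (greedy (fun X => (M.eRk X).toNat) f) := by
  refine (greedy_aux hE f (∑ v, key f v + 1)).1.subset fun v hv => ⟨hv, ?_⟩
  exact Nat.lt_succ_of_le (Finset.single_le_sum (f := key f) (fun _ _ => Nat.zero_le _)
    (Finset.mem_univ v))

/-- Level sets of `f` are prefixes of the refined order. Spanning every level is the form in which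
greedy optimality is used. -/
theorem greedy_span {M : Matroid V} (hE : M.E = Set.univ) (f : V → ℕ) (j : ℕ) :
    {v | f v < j} ⊆ M.closure {v | v ∈ greedy (fun X => (M.eRk X).toNat) f ∧ f v < j} := by
  simpa only [key_lt_iff] using (greedy_aux hE f (j * Fintype.card V)).2

end Greedy

-- Layer-cake summation: a weight sum counts, for each `j`, the elements of weight at least `j`, and
-- on each such level independence is compared with spanning.
omit [Fintype V] in
theorem sum_le_sum_of_level_span {M : Matroid V} {w : V → ℕ} {k : ℕ} {I J : Finset V}
    (hI : M.Indep I) (hw : ∀ v, w v ≤ k)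
    (h : ∀ j, 1 ≤ j → j ≤ k → {v | j ≤ w v} ⊆ M.closure {v | v ∈ J ∧ j ≤ w v}) :
    ∑ v ∈ I, w v ≤ ∑ v ∈ J, w v := by
  classical
  have hsum : ∀ K : Finset V,
      ∑ v ∈ K, w v = ∑ j ∈ Finset.Icc 1 k, (K.filter fun v => j ≤ w v).card := fun K => by
    simp only [Finset.card_filter]
    rw [Finset.sum_comm]
    refine Finset.sum_congr rfl fun v _ => ?_
    rw [← Finset.card_filter, show (Finset.Icc 1 k).filter (· ≤ w v) = Finset.Icc 1 (w v) from ?_]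
    · simp
    · ext j
      have := hw v
      simp only [Finset.mem_filter, Finset.mem_Icc]
      omega
  rw [hsum, hsum]
  refine Finset.sum_le_sum fun j hj => ?_
  rw [Finset.mem_Icc] at hj
  refine (hI.subset (Finset.coe_subset.2 (Finset.filter_subset _ I))).card_le_of_subset_closure
    fun v hv => ?_
  have hv' : v ∈ {v | j ≤ w v} := (Finset.mem_filter.1 (Finset.mem_coe.1 hv)).2
  have := h j hj.1 hj.2 hv'
  convert this using 2
  ext
  simp

/-! ### The auction -/

section Auction

/-- The state of the auction: the number of times each element has been raised, a basis of the first
matroid and an independent set of the second matroid. -/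
structure AuctionState (V : Type*) where
  /-- The number of raises. -/
  count : V → ℕ
  /-- The elements demanded by the first matroid. -/
  left : Finset V
  /-- The elements kept by the second matroid. -/
  right : Finset V

variable [DecidableEq V]

namespace AuctionState

/-- The counts after raising all elements that are demanded but not kept. -/
def raise (s : AuctionState V) (v : V) : ℕ :=
  s.count v + if v ∈ s.left \ s.right then 1 else 0

/-- The order in which the first matroid prefers the elements. -/
def leftOrder (s : AuctionState V) (v : V) : ℕ :=
  2 * (s.raise v / 2) + if v ∈ s.left then 0 else 1

/-- The order in which the second matroid prefers the elements. -/
def rightOrder (k : ℕ) (s : AuctionState V) (v : V) : ℕ :=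
  2 * (k - (s.raise v + 1) / 2) + if v ∈ s.right then 0 else 1

/-- One step of the auction with rank answers `r`: raise the demanded elements that are not kept,
and update both sets. -/
noncomputable def step (k : ℕ) (r : Query V → ℕ) (s : AuctionState V) : AuctionState V where
  count := s.raise
  left := (greedy (fun X => r (0, X)) s.leftOrder).filter fun v => s.raise v / 2 < k
  right := (greedy (fun X => r (1, X)) (s.rightOrder k)).filter fun v => 1 ≤ s.raise v

/-- The rank queries of one step. -/
noncomputable def queries (k : ℕ) (s : AuctionState V) : Finset (Query V) :=
  Finset.univ.biUnion fun v => {(0, before s.leftOrder v), (0, insert v (before s.leftOrder v)),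
    (1, before (s.rightOrder k) v), (1, insert v (before (s.rightOrder k) v))}

theorem card_queries_le (k : ℕ) (s : AuctionState V) :
    (s.queries k).card ≤ 4 * Fintype.card V := by
  refine (Finset.card_biUnion_le_card_mul _ _ 4 fun v _ => Finset.card_le_four).trans ?_
  rw [Finset.card_univ, mul_comm]

theorem step_congr {k : ℕ} {r r' : Query V → ℕ} {s : AuctionState V}
    (h : ∀ q ∈ s.queries k, r q = r' q) : s.step k r = s.step k r' := by
  have hmem : ∀ v, ∀ q ∈ ({(0, before s.leftOrder v), (0, insert v (before s.leftOrder v)),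
      (1, before (s.rightOrder k) v), (1, insert v (before (s.rightOrder k) v))} :
      Finset (Query V)), r q = r' q := fun v q hq =>
    h q (Finset.mem_biUnion.2 ⟨v, Finset.mem_univ v, hq⟩)
  have h1 : greedy (fun X => r (0, X)) s.leftOrder = greedy (fun X => r' (0, X)) s.leftOrder := by
    ext v
    have e1 := hmem v (0, before s.leftOrder v) (by simp)
    have e2 := hmem v (0, insert v (before s.leftOrder v)) (by simp)
    simp only [greedy, Finset.mem_filter, Finset.mem_univ, true_and]
    convert Iff.rfl using 2
    · exact e1.symm
    · convert e2.symm
  have h2 : greedy (fun X => r (1, X)) (s.rightOrder k) =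
      greedy (fun X => r' (1, X)) (s.rightOrder k) := by
    ext v
    have e1 := hmem v (1, before (s.rightOrder k) v) (by simp)
    have e2 := hmem v (1, insert v (before (s.rightOrder k) v)) (by simp)
    simp only [greedy, Finset.mem_filter, Finset.mem_univ, true_and]
    convert Iff.rfl using 2
    · exact e1.symm
    · convert e2.symm
  simp only [step, h1, h2]

/-- The invariant of the auction. -/
structure Invariant (k : ℕ) (M₁ M₂ : Matroid V) (s : AuctionState V) : Prop where
  right_subset : s.right ⊆ s.left
  left_lt : ∀ v ∈ s.left, s.count v / 2 < k
  count_le : ∀ v, s.count v ≤ 2 * k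
  right_pos : ∀ v ∈ s.right, 1 ≤ s.count v
  left_stable : ∀ v ∈ s.left,
    v ∉ M₁.closure ({u | s.count u / 2 < s.count v / 2} ∪ (s.left \ {v}))
  right_indep : M₂.Indep s.right
  right_span : ∀ j, 1 ≤ j → {v | j ≤ (s.count v + 1) / 2} ⊆
    M₂.closure {v | v ∈ s.right ∧ j ≤ (s.count v + 1) / 2}

/-- The demanded set is an optimal basis of the first matroid. -/
structure LeftOptimal (k : ℕ) (M₁ : Matroid V) (s : AuctionState V) : Prop where
  indep : M₁.Indep s.left
  span : ∀ j ≤ k, {v | s.count v / 2 < j} ⊆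
    M₁.closure {v | v ∈ s.left ∧ s.count v / 2 < j}

/-- The initial state. -/
def init (V : Type*) : AuctionState V := ⟨fun _ => 0, ∅, ∅⟩

variable {k : ℕ} {M₁ M₂ : Matroid V} {s : AuctionState V}

omit [Fintype V] [DecidableEq V] in
theorem invariant_init (k : ℕ) (M₁ M₂ : Matroid V) : (init V).Invariant k M₁ M₂ where
  right_subset := by simp [init]
  left_lt := by simp [init]
  count_le := by simp [init]
  right_pos := by simp [init]
  left_stable := by simp [init]
  right_indep := by simp [init]
  right_span j hj v hv := by
    have : j ≤ ((init V).count v + 1) / 2 := hv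
    simp only [init] at this
    omega

/-- The last bit of `leftOrder` only breaks ties, so the prefixes below `2 * j` are the level sets
of `raise / 2`; for `j ≤ k` the filter in `left` removes nothing from them. -/
theorem leftOptimal_step (hE : M₁.E = Set.univ) (s : AuctionState V) :
    (s.step k (rankOracle M₁ M₂)).LeftOptimal k M₁ where
  indep := (greedy_indep hE s.leftOrder).subset (Finset.coe_subset.2 (Finset.filter_subset _ _))
  span j hj := by
    have h := greedy_span hE s.leftOrder (2 * j)
    have hiff : ∀ v, s.leftOrder v < 2 * j ↔ s.raise v / 2 < j := fun v => by
      simp only [leftOrder]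
      split_ifs <;> omega
    simp only [hiff] at h
    refine h.trans (M₁.closure_mono ?_)
    rintro v ⟨hv, hvj⟩
    exact ⟨Finset.mem_filter.2 ⟨hv, lt_of_lt_of_le hvj hj⟩, hvj⟩

omit [Fintype V] in
theorem Invariant.raise_le (hs : s.Invariant k M₁ M₂) (v : V) : s.raise v ≤ 2 * k := by
  have h1 := hs.count_le v
  rw [raise]
  split_ifs with h
  · have := hs.left_lt v (Finset.mem_sdiff.1 h).1
    omega
  · exact h1

/-- Kept elements are not raised and win ties. Those at least as heavy as `v` span `v` by
`right_span`, and if the second weight of `v` is unchanged they all precede it. -/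
theorem Invariant.notMem_right_step (hE : M₂.E = Set.univ) (hs : s.Invariant k M₁ M₂) {v : V}
    (hv : v ∉ s.right) (heq : (s.raise v + 1) / 2 = (s.count v + 1) / 2) :
    v ∉ (s.step k (rankOracle M₁ M₂)).right := by
  intro hmem
  obtain ⟨hg, hpos⟩ := Finset.mem_filter.1 hmem
  have hg' := (mem_greedy hE).1 hg
  have hspan := hs.right_span ((s.count v + 1) / 2) (by rw [← heq]; omega)
    (show v ∈ {u | (s.count v + 1) / 2 ≤ (s.count u + 1) / 2} by simp)
  refine hg' (M₂.closure_mono ?_ hspan)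
  rintro u ⟨hu, hle⟩
  rw [Finset.mem_coe, mem_before]
  apply key_lt_key
  have hru : s.raise u = s.count u := by simp [raise, hu]
  simp only [rightOrder, hu, hv, if_true, if_false, hru, heq]
  omega

/-- Demanded elements win ties and raising only moves elements back. So whatever precedes `v` is
demanded or was already on a strictly earlier level, and `left_stable` says that such elements do
not span `v`. -/
theorem Invariant.mem_left_step (hE : M₁.E = Set.univ) (hs : s.Invariant k M₁ M₂) {v : V}
    (hv : v ∈ s.left) (heq : s.raise v / 2 = s.count v / 2) :
    v ∈ (s.step k (rankOracle M₁ M₂)).left := by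
  refine Finset.mem_filter.2 ⟨(mem_greedy hE).2 fun hcl => ?_, heq ▸ hs.left_lt v hv⟩
  refine hs.left_stable v hv (M₁.closure_mono ?_ hcl)
  intro u hu
  rw [Finset.mem_coe, mem_before] at hu
  have hne : u ≠ v := fun h => by simp [h] at hu
  have hle := le_of_key_lt_key hu
  have hru : s.count u ≤ s.raise u := Nat.le_add_right _ _
  simp only [leftOrder, hv, if_true, heq] at hle
  by_cases hul : u ∈ s.left
  · exact Or.inr ⟨hul, hne⟩
  · left
    simp only [hul, if_false] at hle
    simp only [Set.mem_ofPred_eq]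
    omega

/-- Parity keeps `right` inside `left`: raising an even count changes only the second weight, so the
element stays demanded; raising an odd count changes only the first weight, so the element is not
newly kept. -/
theorem Invariant.step (hE₁ : M₁.E = Set.univ) (hE₂ : M₂.E = Set.univ)
    (hs : s.Invariant k M₁ M₂) : (s.step k (rankOracle M₁ M₂)).Invariant k M₁ M₂ where
  right_subset v hv := by
    by_cases hvr : v ∈ s.right
    · exact hs.mem_left_step hE₁ (hs.right_subset hvr) (by simp [raise, hvr])
    · by_cases hvl : v ∈ s.left
      · have hraise : s.raise v = s.count v + 1 := by simp [raise, hvl, hvr]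
        rcases Nat.even_or_odd' (s.count v) with ⟨c, hc | hc⟩
        · exact hs.mem_left_step hE₁ hvl (by omega)
        · exact (hs.notMem_right_step hE₂ hvr (by omega) hv).elim
      · have hraise : s.raise v = s.count v := by simp [raise, hvl]
        exact (hs.notMem_right_step hE₂ hvr (by rw [hraise]) hv).elim
  left_lt v hv := (Finset.mem_filter.1 hv).2
  count_le := hs.raise_le
  right_pos v hv := (Finset.mem_filter.1 hv).2
  left_stable v hv hcl := by
    have hopt := leftOptimal_step (k := k) (M₂ := M₂) hE₁ s
    set s' := s.step k (rankOracle M₁ M₂)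
    refine hopt.indep.notMem_closure_sdiff_of_mem (Finset.mem_coe.2 hv)
      (M₁.closure_subset_closure_of_subset_closure ?_ hcl)
    have hlt : s'.count v / 2 < k := (Finset.mem_filter.1 hv).2
    rintro u (hu | hu)
    · refine M₁.closure_mono ?_ (hopt.span _ hlt.le hu)
      rintro x ⟨hx, hxv⟩
      refine ⟨hx, ?_⟩
      rintro rfl
      exact lt_irrefl _ hxv
    · exact M₁.subset_closure _ (by simp [hE₁]) hu
  right_indep := (greedy_indep hE₂ (s.rightOrder k)).subset
    (Finset.coe_subset.2 (Finset.filter_subset _ _))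
  right_span j hj := by
    rcases Nat.lt_or_ge k j with hkj | hjk
    · intro v hv
      have h1 : j ≤ (s.raise v + 1) / 2 := hv
      have h2 := hs.raise_le v
      omega
    · have h := greedy_span hE₂ (s.rightOrder k) (2 * (k - j) + 2)
      have hiff : ∀ v, s.rightOrder k v < 2 * (k - j) + 2 ↔ j ≤ (s.raise v + 1) / 2 := fun v => by
        have := hs.raise_le v
        simp only [rightOrder]
        split_ifs <;> omega
      simp only [hiff] at h
      refine h.trans (M₂.closure_mono ?_)
      rintro v ⟨hv, hvj⟩
      exact ⟨Finset.mem_filter.2 ⟨hv, by omega⟩, hvj⟩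

/-- Kept elements retain positive second weight, so the new kept set spans them. This allows the
auction to run on for a fixed number of rounds after a good state. -/
theorem Invariant.card_right_le_step (hE₁ : M₁.E = Set.univ) (hE₂ : M₂.E = Set.univ)
    (hs : s.Invariant k M₁ M₂) : s.right.card ≤ (s.step k (rankOracle M₁ M₂)).right.card := by
  refine hs.right_indep.card_le_of_subset_closure fun v hv => ?_
  have h1 := hs.right_pos v hv
  have h2 : s.count v ≤ s.raise v := Nat.le_add_right _ _
  refine M₂.closure_mono (fun u hu => hu.1) ((hs.step hE₁ hE₂).right_span 1 le_rfl ?_)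
  change 1 ≤ (s.raise v + 1) / 2
  omega

theorem sum_raise (s : AuctionState V) :
    ∑ v, s.raise v = ∑ v, s.count v + (s.left \ s.right).card := by
  simp only [raise, Finset.sum_add_distrib, Finset.sum_ite_mem, Finset.univ_inter,
    Finset.card_eq_sum_ones]

-- Weak duality for the split weight: the two weights sum to at least `k` on every element of `T`
-- and to at most `k + 1` on `right`, while `left` and `right` maximize them separately. On `left \
-- right` only the first weight, at most `k`, counts.
omit [Fintype V] in
theorem Invariant.mul_card_le (hs : s.Invariant k M₁ M₂) (hopt : s.LeftOptimal k M₁)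
    {T : Finset V} (hT : IsCommonIndep M₁ M₂ T) :
    k * T.card ≤ k * (s.left \ s.right).card + (k + 1) * s.right.card := by
  have h1 : ∑ v ∈ T, (k - s.count v / 2) ≤ ∑ v ∈ s.left, (k - s.count v / 2) := by
    refine sum_le_sum_of_level_span (k := k) hT.1 (fun v => by omega) fun j hj hjk => ?_
    have hiff : ∀ v, s.count v / 2 < k - j + 1 ↔ j ≤ k - s.count v / 2 := fun v => by omega
    simpa only [hiff] using hopt.span (k - j + 1) (by omega)
  have h2 : ∑ v ∈ T, (s.count v + 1) / 2 ≤ ∑ v ∈ s.right, (s.count v + 1) / 2 :=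
    sum_le_sum_of_level_span (k := k) hT.2 (fun v => by have := hs.count_le v; omega)
      fun j hj _ => hs.right_span j hj
  have h3 : k * T.card ≤ ∑ v ∈ T, (k - s.count v / 2) + ∑ v ∈ T, (s.count v + 1) / 2 := by
    rw [← Finset.sum_add_distrib, mul_comm, ← smul_eq_mul]
    exact Finset.card_nsmul_le_sum _ _ _ fun v _ => by omega
  have h4 : ∑ v ∈ s.left \ s.right, (k - s.count v / 2) ≤ (s.left \ s.right).card * k :=
    Finset.sum_le_card_nsmul _ _ _ fun v _ => by omega
  have h5 : ∑ v ∈ s.right, (k - s.count v / 2) + ∑ v ∈ s.right, (s.count v + 1) / 2 ≤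
      s.right.card * (k + 1) := by
    rw [← Finset.sum_add_distrib]
    exact Finset.sum_le_card_nsmul _ _ _ fun v _ => by have := hs.count_le v; omega
  have h6 := Finset.sum_sdiff hs.right_subset (f := fun v => k - s.count v / 2)
  rw [mul_comm k (s.left \ s.right).card, mul_comm (k + 1)]
  omega

end AuctionState

open AuctionState ParallelAlg

/-- The auction: an approximately maximum common independent set, with rank queries. -/
theorem exists_auction (k Δ : ℕ) (hΔ : 0 < Δ) :
    ∃ alg : ParallelAlg (Query V) ℕ (Finset V),
      Within (4 * Fintype.card V) (2 * k * Fintype.card V / Δ + 1) alg ∧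
      ∀ M₁ M₂ : Matroid V, M₁.E = Set.univ → M₂.E = Set.univ →
        IsCommonIndep M₁ M₂ (alg.run (rankOracle M₁ M₂)) ∧
        ∀ T, IsCommonIndep M₁ M₂ T →
          k * T.card ≤ k * Δ + (k + 1) * (alg.run (rankOracle M₁ M₂)).card := by
  set m := 2 * k * Fintype.card V / Δ + 1 with hm
  let stepAlg : AuctionState V → ParallelAlg (Query V) ℕ (AuctionState V) := fun s =>
    (ask (s.queries k)).bind fun r => output (s.step k r)
  have hstep : ∀ s, Within (4 * Fintype.card V) 1 (stepAlg s) := fun s =>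
    ((within_ask (s.queries k)).mono (s.card_queries_le k) le_rfl).bind (T' := 0)
      fun r => .output _ _
  refine ⟨(iter stepAlg m (init V)).bind fun s => output s.right, ?_, fun M₁ M₂ hE₁ hE₂ => ?_⟩
  · simpa using (within_iter hstep m (init V)).bind (T' := 0) (f := fun s => output s.right)
      fun s => .output _ _
  have hrun : ∀ s, (stepAlg s).run (rankOracle M₁ M₂) = s.step k (rankOracle M₁ M₂) := fun s => by
    simp only [stepAlg, run_bind, run]
    exact step_congr fun q hq => run_ask _ _ hq
  rw [run_bind, run_iter]
  simp only [hrun, run]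
  set st : ℕ → AuctionState V := fun i => (fun s => s.step k (rankOracle M₁ M₂))^[i] (init V)
    with hst
  have hsucc : ∀ i, st (i + 1) = (st i).step k (rankOracle M₁ M₂) := fun i =>
    Function.iterate_succ_apply' _ _ _
  have hinv : ∀ i, (st i).Invariant k M₁ M₂ := fun i => by
    induction i with
    | zero => exact invariant_init k M₁ M₂
    | succ i ih => rw [hsucc]; exact ih.step hE₁ hE₂
  have hopt : ∀ i, (st (i + 1)).LeftOptimal k M₁ := fun i => by
    rw [hsucc]
    exact leftOptimal_step hE₁ _
  have hmono : Monotone fun i => (st i).right.card := monotone_nat_of_le_succ fun i => by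
    rw [hsucc]
    exact (hinv i).card_right_le_step hE₁ hE₂
  -- Otherwise each step would add more than `Δ` to the sum of the counts, which is at most `2 * k *
  -- n`. The shift by one is there because the initial state need not be `LeftOptimal`.
  obtain ⟨i, him, hi⟩ : ∃ i < m, ((st (i + 1)).left \ (st (i + 1)).right).card ≤ Δ := by
    by_contra! hcon
    have hsum : ∀ j ≤ m, j * Δ ≤ ∑ v, (st (j + 1)).count v := fun j => by
      induction j with
      | zero => simp
      | succ j ih =>
        intro hj
        have h1 := ih (by omega)
        have h2 := hcon j (by omega)
        have h3 := sum_raise (st (j + 1))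
        have h4 : (st (j + 1 + 1)).count = (st (j + 1)).raise := by rw [hsucc (j + 1)]; rfl
        rw [h4, h3, Nat.succ_mul]
        omega
    have h1 := hsum m le_rfl
    have h2 : ∑ v, (st (m + 1)).count v ≤ Fintype.card V * (2 * k) :=
      Finset.sum_le_card_nsmul _ _ _ fun v _ => (hinv _).count_le v
    have h3 : 2 * k * Fintype.card V < m * Δ := by
      rw [hm, mul_comm _ Δ]
      exact Nat.lt_mul_div_succ _ hΔ
    rw [mul_comm] at h2
    omega
  refine ⟨⟨?_, (hinv m).right_indep⟩, fun T hT => ?_⟩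
  · obtain ⟨j, hj⟩ : ∃ j, m = j + 1 := ⟨_, hm⟩
    have := hopt j
    rw [← hj] at this
    exact this.indep.subset (Finset.coe_subset.2 (hinv m).right_subset)
  · refine ((hinv (i + 1)).mul_card_le (hopt i) hT).trans (Nat.add_le_add ?_ ?_)
    · exact Nat.mul_le_mul_left _ hi
    · exact Nat.mul_le_mul_left _ (hmono (show i + 1 ≤ m by omega))

end Auction

end MatroidIntersection

/-! ### Truncated ranks from independence queries -/

namespace MatroidIntersection

variable {V : Type*}

section RankByIndependence

open Classical in
/-- A numbering of the elements of `Y` by `0, …, Y.card - 1`. -/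
noncomputable def index (Y : Finset V) (v : V) : ℕ :=
  if h : v ∈ Y then Y.equivFin ⟨v, h⟩ else 0

theorem index_lt {Y : Finset V} {v : V} (hv : v ∈ Y) : index Y v < Y.card := by
  rw [index, dif_pos hv]
  exact Fin.is_lt _

theorem index_injOn (Y : Finset V) : Set.InjOn (index Y) Y := fun u hu v hv h => by
  rw [index, index, dif_pos (Finset.mem_coe.1 hu), dif_pos (Finset.mem_coe.1 hv)] at h
  exact congrArg Subtype.val (Y.equivFin.injective (Fin.ext h))

theorem exists_index_eq {Y : Finset V} {i : ℕ} (hi : i < Y.card) : ∃ v ∈ Y, index Y v = i := by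
  refine ⟨(Y.equivFin.symm ⟨i, hi⟩).1, (Y.equivFin.symm ⟨i, hi⟩).2, ?_⟩
  rw [index, dif_pos (Y.equivFin.symm ⟨i, hi⟩).2]
  simp

/-- The state of the search for a basis: an independent set, and the elements that are still to be
considered. -/
structure BasisState (V : Type*) where
  /-- The independent set. -/
  basis : Finset V
  /-- The remaining elements. -/
  rest : Finset V

namespace BasisState

variable [DecidableEq V]

/-- The independent set, and the elements before `v` in its block of size `b`. -/
noncomputable def block (s : BasisState V) (b : ℕ) (v : V) : Finset V :=
  s.basis ∪ s.rest.filter fun u =>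
    index s.rest u / b = index s.rest v / b ∧ index s.rest u < index s.rest v

/-- `v` is the last element of a block that can be added as a whole. -/
def Accepts (s : BasisState V) (b : ℕ) (f : Finset V → Bool) (v : V) : Prop :=
  v ∈ s.rest ∧ index s.rest v % b + 1 = b ∧ f (insert v (s.block b v)) = true

open Classical in
/-- Add a whole block, or discard an element of every block. -/
noncomputable def step (s : BasisState V) (b : ℕ) (f : Finset V → Bool) : BasisState V :=
  if h : ∃ v, s.Accepts b f v then
    ⟨insert h.choose (s.block b h.choose), s.rest \ insert h.choose (s.block b h.choose)⟩
  else
    ⟨s.basis, s.rest.filter fun v =>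
      ¬ (f (s.block b v) = true ∧ f (insert v (s.block b v)) = false)⟩

/-- The independence queries of a step. -/
noncomputable def queries (s : BasisState V) (b : ℕ) : Finset (Finset V) :=
  s.rest.image (s.block b) ∪ s.rest.image fun v => insert v (s.block b v)

theorem card_queries_le [Fintype V] (s : BasisState V) (b : ℕ) :
    (s.queries b).card ≤ 2 * Fintype.card V := by
  refine (Finset.card_union_le _ _).trans ?_
  have h1 := Finset.card_image_le (s := s.rest) (f := s.block b)
  have h2 := Finset.card_image_le (s := s.rest) (f := fun v => insert v (s.block b v))
  have h3 := Finset.card_le_univ s.rest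
  omega

/-- The invariant of the search for a basis of `X`. -/
structure Invariant (M : Matroid V) (X : Finset V) (s : BasisState V) : Prop where
  indep : M.Indep s.basis
  basis_subset : s.basis ⊆ X
  rest_subset : s.rest ⊆ X
  disj : Disjoint s.basis s.rest
  span : (X : Set V) ⊆ M.closure (s.basis ∪ s.rest)

variable {M : Matroid V} {X : Finset V} {s : BasisState V} {f : Finset V → Bool} {b : ℕ}

/-- A discarded element is the first failure in its block, so it is spanned by the basis and its
predecessors there. Those are not discarded in the same step, so simultaneous discards keep the
span. -/
theorem Invariant.step (hE : M.E = Set.univ) (hs : s.Invariant M X)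
    (hf : ∀ Z ∈ s.queries b, f Z = true ↔ M.Indep Z) : (s.step b f).Invariant M X := by
  classical
  have hq1 : ∀ v ∈ s.rest, (f (s.block b v) = true ↔ M.Indep (s.block b v)) := fun v hv =>
    hf _ (Finset.mem_union_left _ (Finset.mem_image_of_mem _ hv))
  have hq2 : ∀ v ∈ s.rest,
      (f (insert v (s.block b v)) = true ↔ M.Indep (insert v (s.block b v) : Finset V)) :=
    fun v hv => hf _ (Finset.mem_union_right _ (Finset.mem_image_of_mem _ hv))
  by_cases h : ∃ v, s.Accepts b f v
  · have hc := h.choose_spec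
    rw [BasisState.step, dif_pos h]
    set v := h.choose
    have hsub : insert v (s.block b v) ⊆ s.basis ∪ s.rest := by
      refine Finset.insert_subset (Finset.mem_union_right _ hc.1) ?_
      exact Finset.union_subset_union le_rfl (Finset.filter_subset _ _)
    have hbasis : s.basis ⊆ insert v (s.block b v) :=
      Finset.subset_union_left.trans (Finset.subset_insert _ _)
    refine ⟨(hq2 v hc.1).1 hc.2.2, hsub.trans (Finset.union_subset hs.basis_subset hs.rest_subset),
      Finset.sdiff_subset.trans hs.rest_subset, Finset.disjoint_sdiff, hs.span.trans ?_⟩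
    refine M.closure_mono ?_
    rintro x (hx | hx)
    · exact Or.inl (hbasis hx)
    · by_cases hx' : x ∈ insert v (s.block b v)
      · exact Or.inl hx'
      · exact Or.inr (Finset.mem_coe.2 (Finset.mem_sdiff.2 ⟨hx, hx'⟩))
  · rw [BasisState.step, dif_neg h]
    refine ⟨hs.indep, hs.basis_subset, (Finset.filter_subset _ _).trans hs.rest_subset,
      Finset.disjoint_of_subset_right (Finset.filter_subset _ _) hs.disj, hs.span.trans ?_⟩
    refine M.closure_subset_closure_of_subset_closure ?_
    rintro x (hx | hx)
    · exact M.subset_closure _ (by simp [hE]) (Or.inl hx)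
    · by_cases hx' : f (s.block b x) = true ∧ f (insert x (s.block b x)) = false
      · have hi := (hq1 x hx).1 hx'.1
        have hd : ¬ M.Indep (insert x (s.block b x) : Finset V) := fun hcon => by
          rw [(hq2 x hx).2 hcon] at hx'
          exact Bool.noConfusion hx'.2
        have hxb : x ∉ s.block b x := fun hcon => hd (by rwa [Finset.insert_eq_of_mem hcon])
        have hcl : x ∈ M.closure (s.block b x) := by
          by_contra hcon
          apply hd
          rw [Finset.coe_insert]
          exact (Matroid.insert_indep_iff_of_ground_eq_univ hE hi hxb).2 hcon
        refine M.closure_mono ?_ hcl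
        intro u hu
        rcases Finset.mem_union.1 (Finset.mem_coe.1 hu) with hu | hu
        · exact Or.inl hu
        · right
          obtain ⟨hu1, hu2, hu3⟩ := Finset.mem_filter.1 hu
          refine Finset.mem_coe.2 (Finset.mem_filter.2 ⟨hu1, fun hcon => ?_⟩)
          have hui : M.Indep (insert u (s.block b u) : Finset V) := by
            refine hi.subset (Finset.coe_subset.2 (Finset.insert_subset (Finset.mem_union_right _ hu) ?_))
            refine Finset.union_subset_union le_rfl fun w hw => ?_
            obtain ⟨hw1, hw2, hw3⟩ := Finset.mem_filter.1 hw
            exact Finset.mem_filter.2 ⟨hw1, hw2.trans hu2, hw3.trans hu3⟩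
          rw [(hq2 u hu1).2 hui] at hcon
          exact Bool.noConfusion hcon.2
      · exact M.subset_closure _ (by simp [hE]) (Or.inr (Finset.mem_coe.2
          (Finset.mem_filter.2 ⟨hx, hx'⟩)))

/-- If no full block can be added, each of the `s.rest.card / b` full blocks has a first failure,
and these are discarded. -/
theorem Invariant.progress (hs : s.Invariant M X)
    (hf : ∀ Z ∈ s.queries b, f Z = true ↔ M.Indep Z) (hb : 0 < b) :
    (s.basis.card + b ≤ (s.step b f).basis.card ∧ (s.step b f).rest.card + b ≤ s.rest.card) ∨
      ((s.step b f).basis = s.basis ∧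
        (s.step b f).rest.card + s.rest.card / b ≤ s.rest.card) := by
  classical
  by_cases h : ∃ v, s.Accepts b f v
  · left
    have hc := h.choose_spec
    rw [BasisState.step, dif_pos h]
    set v := h.choose
    set i := index s.rest v / b with hi
    have hidx := index_lt hc.1
    have hmod : index s.rest v = b * i + (b - 1) := by
      have := Nat.div_add_mod (index s.rest v) b
      have h2 := hc.2.1
      rw [← hi] at this
      omega
    set K := s.rest.filter fun u => index s.rest u / b = i with hK
    have hKcard : b ≤ K.card := by
      have himg : Finset.Ico (b * i) (b * i + b) ⊆ K.image (index s.rest) := fun j hj => by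
        rw [Finset.mem_Ico] at hj
        obtain ⟨u, hu, rfl⟩ := exists_index_eq (Y := s.rest) (i := j) (by omega)
        refine Finset.mem_image_of_mem _ (Finset.mem_filter.2 ⟨hu, ?_⟩)
        rw [Nat.div_eq_iff hb]
        rw [mul_comm] at hj
        omega
      have := (Finset.card_le_card himg).trans Finset.card_image_le
      rwa [Nat.card_Ico, Nat.add_sub_cancel_left] at this
    have hKsub : K ⊆ insert v (s.block b v) := fun u hu => by
      obtain ⟨hu1, hu2⟩ := Finset.mem_filter.1 hu
      have hule : index s.rest u ≤ index s.rest v := by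
        rw [Nat.div_eq_iff hb, mul_comm] at hu2
        omega
      rcases hule.lt_or_eq with hlt | heq
      · exact Finset.mem_insert_of_mem (Finset.mem_union_right _
          (Finset.mem_filter.2 ⟨hu1, hu2, hlt⟩))
      · rw [index_injOn s.rest hu1 hc.1 heq]
        exact Finset.mem_insert_self _ _
    have hKrest : K ⊆ s.rest := Finset.filter_subset _ _
    constructor
    · have hdisj : Disjoint s.basis K := Finset.disjoint_of_subset_right hKrest hs.disj
      have hsub : s.basis ∪ K ⊆ insert v (s.block b v) :=
        Finset.union_subset (Finset.subset_union_left.trans (Finset.subset_insert _ _)) hKsub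
      have := Finset.card_le_card hsub
      rw [Finset.card_union_of_disjoint hdisj] at this
      exact (Nat.add_le_add_left hKcard _).trans this
    · have h1 := Finset.card_le_card (Finset.sdiff_subset_sdiff (le_refl s.rest) hKsub)
      rw [Finset.card_sdiff_of_subset hKrest] at h1
      have h2 := Finset.card_le_card hKrest
      simp only
      omega
  · right
    rw [BasisState.step, dif_neg h]
    refine ⟨rfl, ?_⟩
    simp only
    set D := s.rest.filter fun v => f (s.block b v) = true ∧ f (insert v (s.block b v)) = false
    have hDcard : s.rest.card / b ≤ D.card := by
      have himg : Finset.range (s.rest.card / b) ⊆ D.image fun v => index s.rest v / b := by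
        intro j hj
        rw [Finset.mem_range] at hj
        have hjb : b * j + b ≤ s.rest.card := by
          have := (Nat.le_div_iff_mul_le hb).1 (Nat.succ_le_of_lt hj)
          rw [Nat.succ_mul, mul_comm] at this
          exact this
        have hdep : ∃ l, l < b ∧ ∃ v ∈ s.rest, index s.rest v = b * j + l ∧
            f (insert v (s.block b v)) = false := by
          obtain ⟨v, hv, hvi⟩ := exists_index_eq (Y := s.rest) (i := b * j + (b - 1)) (by omega)
          refine ⟨b - 1, by omega, v, hv, hvi, ?_⟩
          by_contra hcon
          refine h ⟨v, hv, ?_, by simpa using hcon⟩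
          rw [hvi, Nat.mul_add_mod, Nat.mod_eq_of_lt (by omega)]
          omega
        obtain ⟨hl, v, hv, hvi, hvf⟩ := Nat.find_spec hdep
        set l := Nat.find hdep with hldef
        have hdiv : ∀ a < b, (b * j + a) / b = j := fun a ha => by
          rw [Nat.mul_add_div hb, Nat.div_eq_of_lt ha, Nat.add_zero]
        refine Finset.mem_image.2 ⟨v, Finset.mem_filter.2 ⟨hv, ?_, hvf⟩, by
          rw [hvi]; exact hdiv l hl⟩
        rw [hf _ (Finset.mem_union_left _ (Finset.mem_image_of_mem _ hv))]
        -- The set before the first failure is independent: for `l = 0` it is the basis, otherwise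
        -- the predecessor passed the test by minimality of `l`.
        rcases Nat.eq_zero_or_pos l with hl0 | hlpos
        · refine hs.indep.subset (Finset.coe_subset.2 (Finset.union_subset le_rfl fun u hu => ?_))
          obtain ⟨-, hu2, hu3⟩ := Finset.mem_filter.1 hu
          rw [hvi, hdiv l hl, Nat.div_eq_iff hb, mul_comm] at hu2
          omega
        · obtain ⟨w, hw, hwi⟩ := exists_index_eq (Y := s.rest) (i := b * j + (l - 1)) (by omega)
          have hwf : f (insert w (s.block b w)) = true := by
            by_contra hcon
            exact Nat.find_min hdep (m := l - 1) (by omega)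
              ⟨by omega, w, hw, hwi, by simpa using hcon⟩
          rw [hf _ (Finset.mem_union_right _ (Finset.mem_image_of_mem _ hw))] at hwf
          refine hwf.subset (Finset.coe_subset.2 (Finset.union_subset
            (Finset.subset_union_left.trans (Finset.subset_insert _ _)) fun u hu => ?_))
          obtain ⟨hu1, hu2, hu3⟩ := Finset.mem_filter.1 hu
          have hwu : index s.rest u ≤ index s.rest w := by omega
          rcases hwu.lt_or_eq with hlt | heq
          · refine Finset.mem_insert_of_mem (Finset.mem_union_right _
              (Finset.mem_filter.2 ⟨hu1, ?_, hlt⟩))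
            rw [hu2, hvi, hwi, hdiv l hl, hdiv _ (by omega)]
          · rw [index_injOn s.rest hu1 hw heq]
            exact Finset.mem_insert_self _ _
      have := (Finset.card_le_card himg).trans Finset.card_image_le
      rwa [Finset.card_range] at this
    have hcard : ∀ Z : Finset V, (∀ v, v ∈ Z ↔ v ∈ s.rest ∧ v ∉ D) →
        Z.card + s.rest.card / b ≤ s.rest.card := fun Z hZ => by
      have hZD : Z = s.rest \ D := by
        ext v
        rw [hZ, Finset.mem_sdiff]
      have h1 := Finset.card_sdiff_add_card_eq_card (Finset.filter_subset _ _ : D ⊆ s.rest)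
      rw [← hZD] at h1
      exact (Nat.add_le_add_left hDcard _).trans h1.le
    refine hcard _ fun v => ?_
    simp only [D, Finset.mem_filter]
    tauto

end BasisState

/-- The number of rounds in which the search for a basis terminates. -/
noncomputable def basisRounds (n t : ℕ) : ℕ :=
  Nat.sqrt t + 3 + ⌈2 * Nat.sqrt t * Real.log (n / t)⌉₊ + 3 * (Nat.sqrt t + 1)

/-- The sizes of the independent set (`c`) and of the remaining set (`m`) in the search for a basis:
with blocks of size `√(min m t)`, the search ends within `basisRounds n t` steps. -/
theorem card_of_basisRounds {n t : ℕ} (ht : 0 < t) (c m : ℕ → ℕ) (hm : m 0 ≤ n)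
    (hstep : ∀ i, 0 < Nat.sqrt (min (m i) t) →
      (c i + Nat.sqrt (min (m i) t) ≤ c (i + 1) ∧ m (i + 1) + Nat.sqrt (min (m i) t) ≤ m i) ∨
      (c (i + 1) = c i ∧ m (i + 1) + m i / Nat.sqrt (min (m i) t) ≤ m i))
    (hzero : ∀ i, Nat.sqrt (min (m i) t) = 0 → c i ≤ c (i + 1) ∧ m (i + 1) ≤ m i) :
    t ≤ c (basisRounds n t) ∨ m (basisRounds n t) = 0 := by
  have hmono : ∀ i, c i ≤ c (i + 1) ∧ m (i + 1) ≤ m i := fun i => by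
    rcases Nat.eq_zero_or_pos (Nat.sqrt (min (m i) t)) with h | h
    · exact hzero i h
    · rcases hstep i h with h | h
      · omega
      · exact ⟨h.1.ge, (Nat.le_add_right _ _).trans h.2⟩
  have hc : Monotone c := monotone_nat_of_le_succ fun i => (hmono i).1
  have hma : Antitone m := antitone_nat_of_succ_le fun i => (hmono i).2
  set s := Nat.sqrt t with hs
  have hspos : 0 < s := Nat.sqrt_pos.2 ht
  have hsR : (1 : ℝ) ≤ s := by exact_mod_cast hspos
  have hst : t ≤ s * s + s + s := Nat.sqrt_le_add t
  have hfac : (0 : ℝ) ≤ 1 - 1 / (2 * s) := by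
    rw [sub_nonneg, div_le_one (by positivity)]
    linarith
  -- While more than `t` elements remain, `a` counts the steps that add a block; each of the other
  -- `J - a` steps shrinks the rest by the factor `1 - 1 / (2 * s)`, where the 2 absorbs the
  -- rounding in `m J / s`.
  have phase1 : ∀ J, ∃ a ≤ J, a * s ≤ c J ∧
      (m J ≤ t ∨ (m J : ℝ) ≤ n * (1 - 1 / (2 * s)) ^ (J - a)) := fun J => by
    induction J with
    | zero => exact ⟨0, le_rfl, by simp, Or.inr (by simpa using hm)⟩
    | succ J ih =>
      obtain ⟨a, haJ, hac, hor⟩ := ih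
      rcases Nat.lt_or_ge t (m J) with hlt | hle
      · have hor' : (m J : ℝ) ≤ n * (1 - 1 / (2 * s)) ^ (J - a) :=
          hor.resolve_left (by omega)
        have hmin : min (m J) t = t := min_eq_right hlt.le
        have := hstep J (by rw [hmin]; exact hspos)
        rw [hmin, ← hs] at this
        rcases this with ⟨h1, h2⟩ | ⟨h1, h2⟩
        · refine ⟨a + 1, by omega, by rw [Nat.succ_mul]; omega, Or.inr ?_⟩
          rw [Nat.add_sub_add_right]
          exact le_trans (by exact_mod_cast (by omega : m (J + 1) ≤ m J)) hor'
        · refine ⟨a, by omega, h1 ▸ hac, Or.inr ?_⟩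
          have hsm : s ≤ m J := (Nat.sqrt_le_self t).trans hlt.le
          have hdiv : m J ≤ 2 * s * (m J / s) := by
            have e1 := Nat.lt_mul_div_succ (m J) hspos
            have e2 : 1 ≤ m J / s := (Nat.one_le_div_iff hspos).2 hsm
            have e3 := Nat.mul_le_mul_left s e2
            rw [Nat.mul_add] at e1
            rw [Nat.mul_assoc]
            omega
          have hdivR : (m J : ℝ) / (2 * s) ≤ (m J / s : ℕ) := by
            rw [div_le_iff₀ (by positivity), mul_comm]
            exact_mod_cast hdiv
          have h2R : (m (J + 1) : ℝ) + (m J / s : ℕ) ≤ m J := by exact_mod_cast h2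
          rw [Nat.succ_sub haJ, pow_succ, ← mul_assoc]
          calc (m (J + 1) : ℝ) ≤ m J - m J / (2 * s) := by linarith
            _ = m J * (1 - 1 / (2 * s)) := by ring
            _ ≤ _ := mul_le_mul_of_nonneg_right hor' hfac
      · exact ⟨a, by omega, hac.trans (hmono J).1, Or.inl ((hmono J).2.trans hle)⟩
  -- Now the block size is `√m`, and either outcome removes at least `√m` elements. Three steps lead
  -- from `(q + 1) ^ 2` to `q ^ 2` since `2 * q + 1 ≤ 3 * q` for `q ≥ 1`; the case `q = 0` is
  -- separate.
  have phase2 : ∀ q i, m i ≤ t → m i ≤ q * q → m (i + 3 * q) = 0 := fun q => by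
    induction q with
    | zero => intro i _ h; simpa using h
    | succ q ih =>
      intro i hit hiq
      have hdec : ∀ j, i ≤ j → m (j + 1) + Nat.sqrt (m j) ≤ m j := fun j hj => by
        have hmin : min (m j) t = m j := min_eq_left ((hma hj).trans hit)
        rcases Nat.eq_zero_or_pos (Nat.sqrt (m j)) with h | h
        · have := (hmono j).2
          omega
        · have h1 := hstep j (by rwa [hmin])
          rw [hmin] at h1
          have h2 : Nat.sqrt (m j) ≤ m j / Nat.sqrt (m j) :=
            (Nat.le_div_iff_mul_le h).2 (Nat.sqrt_le (m j))
          omega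
      have hsub : m (i + 3) ≤ q * q := by
        by_contra hcon
        have h1 := hdec i le_rfl
        have h2 := hdec (i + 1) (by omega)
        have h3 := hdec (i + 2) (by omega)
        have hq : ∀ j, j ≤ i + 3 → q ≤ Nat.sqrt (m j) := fun j hj =>
          Nat.le_sqrt.2 (by have := hma hj; omega)
        have q1 := hq i (by omega)
        have q2 := hq (i + 1) (by omega)
        have q3 := hq (i + 2) (by omega)
        have e : (q + 1) * (q + 1) = q * q + 2 * q + 1 := by ring
        rcases Nat.eq_zero_or_pos q with rfl | hq0
        · have hp : 1 ≤ Nat.sqrt (m i) :=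
            Nat.le_sqrt.2 (by have := hma (show i ≤ i + 3 by omega); omega)
          have := hma (show i + 1 ≤ i + 3 by omega)
          omega
        · simp only [Nat.add_assoc] at h1 h2 h3
          norm_num at h1 h2 h3
          omega
      have := ih (i + 3) ((hma (by omega)).trans hit) hsub
      rwa [show i + 3 * (q + 1) = i + 3 + 3 * q by ring]
  set J := s + 3 + ⌈2 * s * Real.log (n / t)⌉₊ with hJ
  have hrounds : basisRounds n t = J + 3 * (s + 1) := rfl
  obtain ⟨a, haJ, hac, hor⟩ := phase1 J
  -- So many additions give `t` elements, since `t ≤ s * s + 2 * s`. With fewer, at least `⌈2 * s *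
  -- log (n / t)⌉₊` shrinking steps remain, enough to bring `n` down to `t`.
  by_cases ha : s + 3 ≤ a
  · left
    have h1 := Nat.mul_le_mul_right s ha
    have h2 : c J ≤ c (basisRounds n t) := hc (by rw [hrounds]; omega)
    rw [Nat.add_mul] at h1
    omega
  · right
    have hmt : m J ≤ t := by
      rcases hor with h | h
      · exact h
      rcases Nat.eq_zero_or_pos n with rfl | hn
      · have := hma (Nat.zero_le J)
        omega
      have htR : (0 : ℝ) < t := by exact_mod_cast ht
      have hnR : (0 : ℝ) < n := by exact_mod_cast hn
      have hexp : (1 - 1 / (2 * s) : ℝ) ^ (J - a) ≤ t / n := by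
        have h1 : (1 - 1 / (2 * s) : ℝ) ≤ Real.exp (-(1 / (2 * s))) := by
          have := Real.add_one_le_exp (-(1 / (2 * s)) : ℝ)
          linarith
        have h2 : 2 * s * Real.log (n / t) ≤ (J - a : ℕ) := by
          refine (Nat.le_ceil _).trans ?_
          exact_mod_cast (by omega : ⌈2 * (s : ℝ) * Real.log (n / t)⌉₊ ≤ J - a)
        calc (1 - 1 / (2 * s) : ℝ) ^ (J - a) ≤ Real.exp (-(1 / (2 * s))) ^ (J - a) :=
              pow_le_pow_left₀ hfac h1 _
          _ = Real.exp (-((J - a : ℕ) / (2 * s))) := by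
              rw [← Real.exp_nat_mul]
              congr 1
              ring
          _ ≤ Real.exp (-Real.log (n / t)) := by
              rw [Real.exp_le_exp, neg_le_neg_iff, le_div_iff₀ (by positivity)]
              linarith
          _ = t / n := by
              rw [Real.exp_neg, Real.exp_log (by positivity), inv_div]
      have : (m J : ℝ) ≤ t := by
        calc (m J : ℝ) ≤ n * (t / n) := h.trans (mul_le_mul_of_nonneg_left hexp hnR.le)
          _ = t := by field_simp
      exact_mod_cast this
    rw [hrounds]
    refine phase2 (s + 1) J hmt (hmt.trans ?_)
    have : (s + 1) * (s + 1) = s * s + s + s + 1 := by ring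
    omega

open ParallelAlg

/-- The rank of a set, cut off at `t`, can be computed with independence queries. -/
theorem exists_rank_by_indep [Fintype V] {t : ℕ} (ht : 0 < t) (q : Query V) :
    ∃ alg : ParallelAlg (Query V) Bool ℕ,
      Within (2 * Fintype.card V) (basisRounds (Fintype.card V) t) alg ∧
      ∀ M₁ M₂ : Matroid V, M₁.E = Set.univ → M₂.E = Set.univ →
        alg.run (indepOracle M₁ M₂) = min (rankOracle M₁ M₂ q) t := by
  classical
  obtain ⟨i, X⟩ := q
  -- At block size about `√t`, about `√t` additions suffice to reach `t`, and a discarding step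
  -- removes about a `1 / √t` fraction.
  let size : BasisState V → ℕ := fun s => Nat.sqrt (min s.rest.card t)
  let stepAlg : BasisState V → ParallelAlg (Query V) Bool (BasisState V) := fun s =>
    (ask ((s.queries (size s)).image fun Z => (i, Z))).bind fun f =>
      output (s.step (size s) fun Z => f (i, Z))
  have hstep : ∀ s, Within (2 * Fintype.card V) 1 (stepAlg s) := fun s =>
    ((within_ask _).mono (Finset.card_image_le.trans (s.card_queries_le _)) le_rfl).bind (T' := 0)
      fun r => .output _ _
  set R := basisRounds (Fintype.card V) t
  refine ⟨(iter stepAlg R ⟨∅, X⟩).bind fun s => output (min s.basis.card t), ?_,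
    fun M₁ M₂ hE₁ hE₂ => ?_⟩
  · simpa using (within_iter hstep R _).bind (T' := 0)
      (f := fun s => output (min s.basis.card t)) fun s => .output _ _
  set M := ![M₁, M₂] i with hM
  have hE : M.E = Set.univ := by
    fin_cases i
    exacts [hE₁, hE₂]
  let next : BasisState V → BasisState V := fun s => (stepAlg s).run (indepOracle M₁ M₂)
  have hnext : ∀ s, ∃ f : Finset V → Bool, next s = s.step (size s) f ∧
      ∀ Z ∈ s.queries (size s), (f Z = true ↔ M.Indep Z) := fun s => by
    refine ⟨fun Z => (ask ((s.queries (size s)).image fun Z => (i, Z))).run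
      (indepOracle M₁ M₂) (i, Z), ?_, fun Z hZ => ?_⟩
    · simp only [next, stepAlg, run_bind, run]
    · dsimp only
      rw [run_ask _ _ (Finset.mem_image_of_mem (fun Z => (i, Z)) hZ), indepOracle_eq_true_iff]
  rw [run_bind, run_iter]
  simp only [run]
  change min (next^[R] ⟨∅, X⟩).basis.card t = _
  set st : ℕ → BasisState V := fun j => next^[j] ⟨∅, X⟩ with hst
  have hsucc : ∀ j, st (j + 1) = next (st j) := fun j => Function.iterate_succ_apply' _ _ _
  have hinv : ∀ j, (st j).Invariant M X := fun j => by
    induction j with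
    | zero => exact ⟨by simp [hst], by simp [hst], by simp [hst], by simp [hst], by
        simpa [hst] using M.subset_closure (X : Set V) (by simp [hE])⟩
    | succ j ih =>
      obtain ⟨f, hf, hfq⟩ := hnext (st j)
      rw [hsucc, hf]
      exact ih.step hE hfq
  have hrank : rankOracle M₁ M₂ (i, X) = (M.eRk X).toNat := rfl
  have hle : (st R).basis.card ≤ (M.eRk X).toNat := by
    have h1 := (hinv R).indep.encard_le_eRk_of_subset (Finset.coe_subset.2 (hinv R).basis_subset)
    have hfin : M.eRk X ≠ ⊤ := ne_top_of_le_ne_top (by simp) (M.eRk_le_encard X)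
    rw [Set.encard_coe_eq_coe_finsetCard] at h1
    exact ENat.toNat_le_toNat h1 hfin
  have hend := card_of_basisRounds (n := Fintype.card V) ht (fun j => (st j).basis.card)
    (fun j => (st j).rest.card) (Finset.card_le_univ _) (fun j hj => by
      obtain ⟨f, hf, hfq⟩ := hnext (st j)
      rw [hsucc, hf]
      rcases (hinv j).progress hfq hj with h | ⟨h1, h2⟩
      · exact Or.inl h
      · exact Or.inr ⟨by rw [h1], h2⟩) (fun j hj => by
      obtain ⟨f, hf, hfq⟩ := hnext (st j)
      have hzero : (st j).rest.card = 0 := by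
        rw [Nat.sqrt_eq_zero] at hj
        omega
      rw [Finset.card_eq_zero] at hzero
      have hna : ¬ ∃ v, (st j).Accepts (size (st j)) f v := fun ⟨v, hv, _⟩ => by
        simp [hzero] at hv
      rw [hsucc, hf, BasisState.step, dif_neg hna]
      simp [hzero])
  rw [hrank]
  rcases hend with h | h
  · rw [min_eq_right h, min_eq_right (h.trans hle)]
  · refine congrArg (min · t) (le_antisymm hle ?_)
    rw [Finset.card_eq_zero] at h
    have hspan := (hinv R).span
    rw [h, Finset.coe_empty, Set.union_empty] at hspan
    have h1 := (M.eRk_mono hspan).trans ((M.eRk_closure_eq _).le.trans (M.eRk_le_encard _))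
    rw [Set.encard_coe_eq_coe_finsetCard] at h1
    simpa using ENat.toNat_le_toNat h1 (ENat.natCast_ne_top _)

end RankByIndependence

end MatroidIntersection

/-! ### Auction plus augmentation on truncated matroids, and the search for the truncation -/

namespace MatroidIntersection

open ParallelAlg

variable {V : Type*} [Fintype V]

/-- Either all `m` steps gain an element, which exhausts the deficit, or some step reaches a
maximum, which later steps preserve. -/
theorem exists_augment [DecidableEq V] (m : ℕ) (S : Finset V) :
    ∃ alg : ParallelAlg (Query V) Bool (Finset V),
      Within (2 * Fintype.card V + 2 * Fintype.card V ^ 2) m alg ∧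
      ∀ M₁ M₂ : Matroid V, M₁.E = Set.univ → M₂.E = Set.univ → IsCommonIndep M₁ M₂ S →
        (∀ T, IsCommonIndep M₁ M₂ T → T.card ≤ S.card + m) →
        IsMaxCommonIndep M₁ M₂ (alg.run (indepOracle M₁ M₂)) := by
  let stepAlg : Finset V → ParallelAlg (Query V) Bool (Finset V) := fun S =>
    (ask (augmentQueries S)).bind fun f => output (augment f S)
  have hstep : ∀ S, Within (2 * Fintype.card V + 2 * Fintype.card V ^ 2) 1 (stepAlg S) := fun S =>
    ((within_ask _).mono (card_augmentQueries_le S) le_rfl).bind (T' := 0) fun r => .output _ _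
  refine ⟨iter stepAlg m S, by simpa using within_iter hstep m S, fun M₁ M₂ hE₁ hE₂ => ?_⟩
  have hE : ∀ i, (![M₁, M₂] i).E = Set.univ := fun i => by
    fin_cases i
    exacts [hE₁, hE₂]
  have hrun : ∀ S, IsCommonIndep M₁ M₂ S →
      IsCommonIndep M₁ M₂ ((stepAlg S).run (indepOracle M₁ M₂)) ∧
        (((stepAlg S).run (indepOracle M₁ M₂)).card = S.card + 1 ∨
          IsMaxCommonIndep M₁ M₂ ((stepAlg S).run (indepOracle M₁ M₂))) := fun S hS => by
    simp only [stepAlg, run_bind, run]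
    exact augment_spec hE hS fun q hq => run_ask _ _ hq
  have hmax : ∀ S, IsMaxCommonIndep M₁ M₂ S →
      IsMaxCommonIndep M₁ M₂ ((stepAlg S).run (indepOracle M₁ M₂)) := fun S hS => by
    obtain ⟨h1, h2 | h2⟩ := hrun S hS.1
    · have := hS.2 _ h1
      omega
    · exact h2
  rw [run_iter]
  induction m generalizing S with
  | zero => exact fun hS h => ⟨hS, by simpa using h⟩
  | succ m ih =>
    intro hS h
    rw [Function.iterate_succ_apply]
    obtain ⟨h1, h2 | h2⟩ := hrun S hS
    · exact ih _ h1 fun T hT => by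
        rw [h2]
        have := h T hT
        omega
    · exact ih _ h1 fun T hT => (h2.2 T hT).trans (Nat.le_add_right _ _)

theorem isCommonIndep_truncateTo {M₁ M₂ : Matroid V} {t : ℕ} {S : Finset V} :
    IsCommonIndep (M₁.truncateTo t) (M₂.truncateTo t) S ↔ IsCommonIndep M₁ M₂ S ∧ S.card ≤ t := by
  simp only [IsCommonIndep, Matroid.truncateTo_indep]
  tauto

/-- A larger common independent set would contain one of size `S.card + 1 ≤ t`, which survives
truncation. This makes a sufficient guess recognizable without knowing the optimum. -/
theorem IsMaxCommonIndep.of_truncateTo {M₁ M₂ : Matroid V} {t : ℕ} {S : Finset V}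
    (h : IsMaxCommonIndep (M₁.truncateTo t) (M₂.truncateTo t) S) (hS : S.card < t) :
    IsMaxCommonIndep M₁ M₂ S := by
  refine ⟨(isCommonIndep_truncateTo.1 h.1).1, fun T hT => ?_⟩
  by_contra hcon
  obtain ⟨T', hT', hcard⟩ := Finset.exists_subset_card_eq (Nat.succ_le_of_lt (not_le.1 hcon))
  have := h.2 T' (isCommonIndep_truncateTo.2 ⟨⟨hT.1.subset (by exact_mod_cast hT'),
    hT.2.subset (by exact_mod_cast hT')⟩, by omega⟩)
  omega

theorem card_le_answerSize {M₁ M₂ : Matroid V} {S : Finset V} (hS : IsCommonIndep M₁ M₂ S) :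
    S.card ≤ answerSize M₁ M₂ := by
  classical
  exact Finset.le_sup (f := Finset.card) (Finset.mem_filter.2 ⟨Finset.mem_univ S, hS⟩)

theorem answerSize_le_card (M₁ M₂ : Matroid V) : answerSize M₁ M₂ ≤ Fintype.card V := by
  classical
  exact Finset.sup_le fun S _ => Finset.card_le_univ S

theorem truncateTo_indepOracle {M₁ M₂ : Matroid V} {t : ℕ} {q : Query V} :
    indepOracle (M₁.truncateTo t) (M₂.truncateTo t) q =
      (indepOracle M₁ M₂ q && decide (q.2.card ≤ t)) := by
  obtain ⟨i, X⟩ := q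
  rw [Bool.eq_iff_iff, Bool.and_eq_true, indepOracle_eq_true_iff, indepOracle_eq_true_iff,
    decide_eq_true_iff, ← Matroid.truncateTo_indep]
  fin_cases i <;> rfl

theorem truncateTo_rankOracle {M₁ M₂ : Matroid V} {t : ℕ} {q : Query V} :
    rankOracle (M₁.truncateTo t) (M₂.truncateTo t) q = min (rankOracle M₁ M₂ q) t := by
  obtain ⟨i, X⟩ := q
  fin_cases i <;> exact Matroid.truncateTo_eRk _ _ _

omit [Fintype V] in
theorem indepOracle_eq_rankOracle {M₁ M₂ : Matroid V} {q : Query V} :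
    indepOracle M₁ M₂ q = decide (rankOracle M₁ M₂ q = q.2.card) := by
  obtain ⟨i, X⟩ := q
  rw [Bool.eq_iff_iff, indepOracle_eq_true_iff, decide_eq_true_iff, rankOracle,
    Matroid.indep_iff_eRk_eq_encard_of_finite (Finset.finite_toSet X),
    Set.encard_coe_eq_coe_finsetCard]
  have hfin : (![M₁, M₂] i).eRk X ≠ ⊤ := ne_top_of_le_ne_top (by simp) (Matroid.eRk_le_encard _ _)
  generalize (![M₁, M₂] i).eRk X = e at hfin
  lift e to ℕ using hfin
  simp

variable {A : Type*} (oracle : Matroid V → Matroid V → Query V → A)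

/-- `Simulates oracle target N R`: a query to `target` can be answered with `R` rounds of at most `N`
queries to `oracle`. -/
def Simulates {B : Type*} (target : Matroid V → Matroid V → Query V → B) (N R : ℕ) : Prop :=
  ∀ q, ∃ alg : ParallelAlg (Query V) A B, Within N R alg ∧
    ∀ M₁ M₂ : Matroid V, M₁.E = Set.univ → M₂.E = Set.univ →
      alg.run (oracle M₁ M₂) = target M₁ M₂ q

variable {oracle}

omit [Fintype V] in
theorem Simulates.exists_alg {B O : Type*} {target : Matroid V → Matroid V → Query V → B}
    {N R N' T : ℕ} (h : Simulates oracle target N R) {a : ParallelAlg (Query V) B O}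
    (ha : Within N' T a) :
    ∃ b : ParallelAlg (Query V) A O, Within (N' * N) (T * R) b ∧
      ∀ M₁ M₂ : Matroid V, M₁.E = Set.univ → M₂.E = Set.univ →
        b.run (oracle M₁ M₂) = a.run (target M₁ M₂) := by
  choose sub hsub hrun using h
  obtain ⟨b, hb, hbrun⟩ := exists_simulate sub hsub ha
  refine ⟨b, hb, fun M₁ M₂ hE₁ hE₂ => ?_⟩
  rw [hbrun]
  congr 1
  funext q
  exact hrun q M₁ M₂ hE₁ hE₂

section Truncated

variable {t : ℕ} (hI : Simulates oracle
  (fun M₁ M₂ => indepOracle (M₁.truncateTo t) (M₂.truncateTo t)) 1 1)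

include hI

/-- Matroid intersection for truncated matroids, by augmentations only. -/
theorem exists_truncated_of_augment :
    ∃ alg : ParallelAlg (Query V) A (Finset V),
      Within (2 * Fintype.card V + 2 * Fintype.card V ^ 2) t alg ∧
      ∀ M₁ M₂ : Matroid V, M₁.E = Set.univ → M₂.E = Set.univ →
        IsMaxCommonIndep (M₁.truncateTo t) (M₂.truncateTo t) (alg.run (oracle M₁ M₂)) := by
  classical
  obtain ⟨a, ha, hmax⟩ := exists_augment t (∅ : Finset V)
  obtain ⟨b, hb, hrun⟩ := hI.exists_alg ha
  refine ⟨b, by simpa using hb, fun M₁ M₂ hE₁ hE₂ => ?_⟩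
  rw [hrun M₁ M₂ hE₁ hE₂]
  refine hmax _ _ hE₁ hE₂ (by simp [IsCommonIndep]) fun T hT => ?_
  simpa using (isCommonIndep_truncateTo.1 hT).2

/-- Matroid intersection for truncated matroids, by an auction followed by augmentations. -/
theorem exists_truncated_of_auction {N R : ℕ}
    (hR : Simulates oracle (fun M₁ M₂ => rankOracle (M₁.truncateTo t) (M₂.truncateTo t)) N R)
    {k Δ : ℕ} (hk : 0 < k) (hΔ : 0 < Δ) :
    ∃ alg : ParallelAlg (Query V) A (Finset V),
      Within (4 * Fintype.card V * N + (2 * Fintype.card V + 2 * Fintype.card V ^ 2))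
        ((2 * k * Fintype.card V / Δ + 1) * R + (Δ + t / k)) alg ∧
      ∀ M₁ M₂ : Matroid V, M₁.E = Set.univ → M₂.E = Set.univ →
        IsMaxCommonIndep (M₁.truncateTo t) (M₂.truncateTo t) (alg.run (oracle M₁ M₂)) := by
  classical
  obtain ⟨a, ha, happrox⟩ := exists_auction (V := V) k Δ hΔ
  obtain ⟨b, hb, hbrun⟩ := hR.exists_alg ha
  choose c hc hmax using exists_augment (V := V) (Δ + t / k)
  choose d hd hdrun using fun S => hI.exists_alg (hc S)
  refine ⟨b.bind d, (hb.mono (Nat.le_add_right _ _) le_rfl).bind fun S => (hd S).mono ?_ ?_,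
    fun M₁ M₂ hE₁ hE₂ => ?_⟩
  · rw [mul_one]
    exact Nat.le_add_left _ _
  · rw [mul_one]
  · rw [run_bind, hdrun _ M₁ M₂ hE₁ hE₂, hbrun M₁ M₂ hE₁ hE₂]
    obtain ⟨h1, h2⟩ := happrox (M₁.truncateTo t) (M₂.truncateTo t) hE₁ hE₂
    refine hmax _ _ _ hE₁ hE₂ h1 fun T hT => ?_
    have h3 := h2 T hT
    set S := a.run (rankOracle (M₁.truncateTo t) (M₂.truncateTo t))
    have hSt : S.card ≤ t := (isCommonIndep_truncateTo.1 h1).2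
    by_contra hcon
    -- The auction guarantees `k * (T.card - S.card - Δ) ≤ S.card ≤ t`, so the deficit cannot exceed
    -- `Δ + t / k`.
    have h4 : t / k + 1 ≤ T.card - S.card - Δ := by omega
    have h5 : t < k * (T.card - S.card - Δ) :=
      (Nat.lt_mul_div_succ t hk).trans_le (Nat.mul_le_mul_left k h4)
    rw [Nat.mul_sub, Nat.mul_sub] at h5
    rw [Nat.add_mul, Nat.one_mul] at h3
    omega

end Truncated

/-- Algorithms for the truncated matroids combine to an algorithm for matroid intersection. -/
theorem exists_of_truncated {N : ℕ} (T : ℕ → ℕ)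
    (h : ∀ t, 0 < t → ∃ alg : ParallelAlg (Query V) A (Finset V), Within N (T t) alg ∧
      ∀ M₁ M₂ : Matroid V, M₁.E = Set.univ → M₂.E = Set.univ →
        IsMaxCommonIndep (M₁.truncateTo t) (M₂.truncateTo t) (alg.run (oracle M₁ M₂))) :
    ∃ alg : ParallelAlg (Query V) A (Finset V),
      ∀ M₁ M₂ : Matroid V, M₁.E = Set.univ → M₂.E = Set.univ →
        IsMaxCommonIndep M₁ M₂ (alg.run (oracle M₁ M₂)) ∧
        alg.maxQueries (oracle M₁ M₂) ≤ N ∧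
        alg.rounds (oracle M₁ M₂) ≤ 4 * T (answerSize M₁ M₂ + 1) + 1 := by
  -- The guess `t = 0` gets a dummy algorithm; it is never accepted, because acceptance requires
  -- `S.card < t`.
  have h' : ∀ t, ∃ alg : ParallelAlg (Query V) A (Finset V), Within N (T t) alg ∧
      (0 < t → ∀ M₁ M₂ : Matroid V, M₁.E = Set.univ → M₂.E = Set.univ →
        IsMaxCommonIndep (M₁.truncateTo t) (M₂.truncateTo t) (alg.run (oracle M₁ M₂))) := fun t => by
    rcases Nat.eq_zero_or_pos t with rfl | ht
    · exact ⟨output ∅, .output _ _, fun h => (lt_irrefl _ h).elim⟩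
    · obtain ⟨alg, h1, h2⟩ := h t ht
      exact ⟨alg, h1, fun _ => h2⟩
  choose alg halg hmax using h'
  obtain ⟨b, hb⟩ := exists_search alg T N (Fintype.card V + 1) (fun t S => S.card < t)
    fun t _ => halg t
  refine ⟨b, fun M₁ M₂ hE₁ hE₂ => ?_⟩
  -- From `t = r + 1` on, every common independent set has fewer than `t` elements, so the guess is
  -- accepted.
  obtain ⟨⟨t, -, hacc, hrun⟩, hq, hr⟩ := hb (oracle M₁ M₂) (answerSize M₁ M₂ + 1)
    (Nat.succ_le_succ (answerSize_le_card M₁ M₂)) fun t _ ht => by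
      have h1 := (isCommonIndep_truncateTo.1 (hmax t (by omega) M₁ M₂ hE₁ hE₂).1).1
      have h2 := card_le_answerSize h1
      change _ < t
      omega
  refine ⟨?_, hq, hr⟩
  rw [hrun]
  exact (hmax t (by omega) M₁ M₂ hE₁ hE₂).of_truncateTo hacc

theorem simulates_rank_rank (t : ℕ) : Simulates (V := V) rankOracle
    (fun M₁ M₂ => rankOracle (M₁.truncateTo t) (M₂.truncateTo t)) 1 1 := fun q =>
  ⟨(ask {q}).bind fun f => output (min (f q) t), (within_ask {q}).bind (T' := 0)
    fun _ => .output _ _, fun M₁ M₂ _ _ => by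
      simp only [run_bind, run, truncateTo_rankOracle]
      rw [run_ask _ _ (Finset.mem_singleton_self q)]⟩

theorem simulates_rank_indep (t : ℕ) : Simulates (V := V) rankOracle
    (fun M₁ M₂ => indepOracle (M₁.truncateTo t) (M₂.truncateTo t)) 1 1 := fun q =>
  ⟨(ask {q}).bind fun f => output (decide (f q = q.2.card) && decide (q.2.card ≤ t)),
    (within_ask {q}).bind (T' := 0) fun _ => .output _ _, fun M₁ M₂ _ _ => by
      simp only [run_bind, run, truncateTo_indepOracle]
      rw [run_ask _ _ (Finset.mem_singleton_self q), indepOracle_eq_rankOracle]⟩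

theorem simulates_indep_indep (t : ℕ) : Simulates (V := V) indepOracle
    (fun M₁ M₂ => indepOracle (M₁.truncateTo t) (M₂.truncateTo t)) 1 1 := fun q =>
  ⟨(ask {q}).bind fun f => output (f q && decide (q.2.card ≤ t)),
    (within_ask {q}).bind (T' := 0) fun _ => .output _ _, fun M₁ M₂ _ _ => by
      simp only [run_bind, run, truncateTo_indepOracle]
      rw [run_ask _ _ (Finset.mem_singleton_self q)]⟩

theorem simulates_indep_rank {t : ℕ} (ht : 0 < t) : Simulates (V := V) indepOracle
    (fun M₁ M₂ => rankOracle (M₁.truncateTo t) (M₂.truncateTo t))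
    (2 * Fintype.card V) (basisRounds (Fintype.card V) t) := fun q => by
  simp only [truncateTo_rankOracle]
  exact exists_rank_by_indep ht q

end MatroidIntersection

/-! ### Choice of parameters and round counts -/

namespace MatroidIntersection

open Classical in
/-- The number of rounds for guess `t`: only augmentations if `small`, else an auction with cutoff
`⌈z⌉` in which each step takes `R` rounds, followed by augmentations. -/
noncomputable def guessRounds (n t R : ℕ) (z : ℝ) (small : Prop) : ℕ :=
  if small then t else
    (2 * (t / ⌈z⌉₊ + 1) * n / ⌈z⌉₊ + 1) * R + (⌈z⌉₊ + t / (t / ⌈z⌉₊ + 1))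

/-- With `Δ = ⌈z⌉₊ ≤ 2 * z`, the choice `k = t / Δ + 1` is just large enough for `t / k ≤ Δ`, so the
augmentations cost at most `4 * z`. The other terms are the auction. -/
theorem guessRounds_le {n t R : ℕ} {z : ℝ} {small : Prop} (hz : 1 ≤ z) (hsmall : ¬ small) :
    (guessRounds n t R z small : ℝ) ≤ (2 * n * t / z ^ 2 + 2 * n / z + 1) * R + 4 * z := by
  rw [guessRounds, if_neg hsmall]
  have hzpos : 0 < z := by linarith
  set Δ := ⌈z⌉₊ with hΔ
  have h1 : z ≤ Δ := Nat.le_ceil z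
  have h2 : (Δ : ℝ) ≤ 2 * z := by
    have := (Nat.ceil_lt_add_one hzpos.le).le
    linarith
  have hΔpos : 0 < Δ := Nat.ceil_pos.2 hzpos
  have h3 : t / (t / Δ + 1) ≤ Δ := by
    apply Nat.le_of_lt_succ
    rw [Nat.div_lt_iff_lt_mul (Nat.succ_pos _)]
    have := Nat.lt_mul_div_succ t hΔpos
    exact this.trans_le (Nat.mul_le_mul_right _ Δ.le_succ)
  have h4 : ((2 * (t / Δ + 1) * n / Δ : ℕ) : ℝ) ≤ 2 * n * t / z ^ 2 + 2 * n / z := by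
    have e1 : ((t / Δ : ℕ) : ℝ) ≤ t / z := Nat.cast_div_le.trans
      (div_le_div_of_nonneg_left (Nat.cast_nonneg _) hzpos h1)
    calc ((2 * (t / Δ + 1) * n / Δ : ℕ) : ℝ) ≤ ((2 * (t / Δ + 1) * n : ℕ) : ℝ) / Δ :=
          Nat.cast_div_le
      _ ≤ ((2 * (t / Δ + 1) * n : ℕ) : ℝ) / z :=
          div_le_div_of_nonneg_left (Nat.cast_nonneg _) hzpos h1
      _ = 2 * ((t / Δ : ℕ) + 1) * n / z := by push_cast; ring
      _ ≤ 2 * (t / z + 1) * n / z := by gcongr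
      _ = 2 * n * t / z ^ 2 + 2 * n / z := by field_simp
  have h5 : ((Δ + t / (t / Δ + 1) : ℕ) : ℝ) ≤ 4 * z := by
    have : ((Δ + t / (t / Δ + 1) : ℕ) : ℝ) ≤ ((Δ + Δ : ℕ) : ℝ) := by
      exact_mod_cast Nat.add_le_add_left h3 Δ
    push_cast at this ⊢
    linarith
  rw [Nat.cast_add, Nat.cast_mul, Nat.cast_add, Nat.cast_one]
  gcongr

theorem one_le_of_pow_le {a b : ℝ} (hb : 0 ≤ b) (ha : 1 ≤ a) {m : ℕ} (hm : m ≠ 0)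
    (h : a ≤ b ^ m) : 1 ≤ b := by
  by_contra hcon
  have := pow_lt_one₀ hb (not_le.1 hcon) hm
  linarith

/-- Put `t = r + 1`. The choice of `z` makes `n * t / z ^ 2 = z`, and `n / z ≤ z` amounts to `n ≤ t
^ 2`. If instead `t ^ 2 ≤ n`, then `r` itself is at most `n ^ (1 / 3) * r ^ (1 / 3)`. -/
theorem rank_rounds_le {n r : ℕ} (hrn : r ≤ n) :
    (4 * guessRounds n (r + 1) 1 (((n : ℝ) * (r + 1 : ℕ)) ^ (1 / 3 : ℝ))
        ((r + 1) * (r + 1) ≤ n ∨ r + 1 ≤ 1) + 1 : ℝ) ≤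
      100 * (1 + (n : ℝ) ^ (1 / 3 : ℝ) * (r : ℝ) ^ (1 / 3 : ℝ)) := by
  set x := (n : ℝ) ^ (1 / 3 : ℝ)
  set y := (r : ℝ) ^ (1 / 3 : ℝ)
  have hx0 : 0 ≤ x := by positivity
  have hy0 : 0 ≤ y := by positivity
  have cube : ∀ a : ℝ, 0 ≤ a → (a ^ (1 / 3 : ℝ)) ^ 3 = a := fun a ha => by
    rw [← Real.rpow_natCast, ← Real.rpow_mul ha]
    norm_num
  have hx : x ^ 3 = n := cube _ (Nat.cast_nonneg _)
  have hy : y ^ 3 = r := cube _ (Nat.cast_nonneg _)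
  by_cases hsmall : (r + 1) * (r + 1) ≤ n ∨ r + 1 ≤ 1
  · rw [guessRounds, if_pos hsmall]
    have hr : (r : ℝ) ≤ x * y := by
      rcases hsmall with h | h
      · have h1 : ((r * r : ℕ) : ℝ) ≤ n := by
          exact_mod_cast le_trans (Nat.mul_le_mul r.le_succ r.le_succ) h
        rw [Nat.cast_mul, ← hx, ← hy] at h1
        have h2 : y ^ 2 ≤ x := by
          refine le_of_pow_le_pow_left₀ (n := 3) (by norm_num) hx0 ?_
          calc (y ^ 2) ^ 3 = y ^ 3 * y ^ 3 := by ring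
            _ ≤ x ^ 3 := h1
        calc (r : ℝ) = y ^ 2 * y := by rw [← hy]; ring
          _ ≤ x * y := by gcongr
      · have : r = 0 := by omega
        rw [this, Nat.cast_zero]
        positivity
    push_cast
    nlinarith
  · set z := ((n : ℝ) * (r + 1 : ℕ)) ^ (1 / 3 : ℝ)
    have hz0 : 0 ≤ z := by positivity
    have hz : z ^ 3 = n * (r + 1 : ℕ) := cube _ (by positivity)
    have hbig := hsmall
    rw [not_or, not_le, not_le] at hbig
    have hr1 : 1 ≤ r := by omega
    have hn1 : 1 ≤ n := hr1.trans hrn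
    have hz1 : 1 ≤ z := one_le_of_pow_le hz0 (a := (n * (r + 1) : ℕ))
      (by exact_mod_cast Nat.mul_pos hn1 (Nat.succ_pos r)) (m := 3) (by norm_num)
      (by rw [hz]; push_cast; rfl)
    have hnz : (n : ℝ) ≤ z ^ 2 := by
      refine le_of_pow_le_pow_left₀ (n := 3) (by norm_num) (by positivity) ?_
      have h1 : (n : ℝ) ≤ (r + 1 : ℕ) * (r + 1 : ℕ) := by exact_mod_cast hbig.1.le
      calc (n : ℝ) ^ 3 = (n : ℝ) ^ 2 * n := by ring
        _ ≤ (n : ℝ) ^ 2 * ((r + 1 : ℕ) * (r + 1 : ℕ)) := by gcongr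
        _ = (z ^ 2) ^ 3 := by
            rw [show (z ^ 2) ^ 3 = z ^ 3 * z ^ 3 by ring, hz]
            ring
    -- Passing from the guess `r + 1` back to `r` costs a constant because `r ≥ 1`; the case `r = 0`
    -- is part of `small`.
    have hzxy : z ≤ 2 * (x * y) := by
      refine le_of_pow_le_pow_left₀ (n := 3) (by norm_num) (by positivity) ?_
      have h1 : ((r + 1 : ℕ) : ℝ) ≤ 8 * r := by exact_mod_cast (by omega : r + 1 ≤ 8 * r)
      calc z ^ 3 = n * (r + 1 : ℕ) := hz
        _ ≤ n * (8 * r) := by gcongr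
        _ = (2 * (x * y)) ^ 3 := by rw [← hx, ← hy]; ring
    have hmain := guessRounds_le (n := n) (t := r + 1) (R := 1) hz1 hsmall
    have h1 : 2 * (n : ℝ) * (r + 1 : ℕ) / z ^ 2 = 2 * z := by
      rw [mul_assoc, ← hz]
      field_simp
    have h2 : 2 * (n : ℝ) / z ≤ 2 * z := by
      rw [div_le_iff₀ (by linarith)]
      nlinarith
    rw [h1, Nat.cast_one] at hmain
    nlinarith

/-- The separate bound `l ≥ 0` is needed because the logarithm is negative for `t = n + 1`, which
occurs as the guess when `r = n`. -/
theorem basisRounds_le {n t : ℕ} {l : ℝ} (ht : 0 < t) (hl : 0 ≤ l)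
    (hlog : Real.log ((n : ℝ) / t) ≤ l) :
    (basisRounds n t : ℝ) ≤ 11 * ((t : ℝ) ^ (1 / 2 : ℝ) * (1 + l)) := by
  have hs : (Nat.sqrt t : ℝ) ≤ (t : ℝ) ^ (1 / 2 : ℝ) := by
    rw [← Real.sqrt_eq_rpow]
    exact Real.nat_sqrt_le_real_sqrt
  have hs1 : (1 : ℝ) ≤ Nat.sqrt t := by exact_mod_cast Nat.sqrt_pos.2 ht
  have hceil : (⌈2 * (Nat.sqrt t : ℝ) * Real.log ((n : ℝ) / t)⌉₊ : ℝ) ≤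
      2 * Nat.sqrt t * l + 1 := by
    calc (⌈2 * (Nat.sqrt t : ℝ) * Real.log ((n : ℝ) / t)⌉₊ : ℝ) ≤ ⌈2 * (Nat.sqrt t : ℝ) * l⌉₊ := by
          exact_mod_cast Nat.ceil_mono (by gcongr)
      _ ≤ _ := (Nat.ceil_lt_add_one (by positivity)).le
  have h1 : (basisRounds n t : ℝ) ≤ 11 * (Nat.sqrt t * (1 + l)) := by
    rw [basisRounds]
    push_cast
    nlinarith
  exact h1.trans (by gcongr)

/-- Put `t = r + 1`. Now `z = n ^ (1 / 3) * t ^ (1 / 2)` makes `n * t / z ^ 2 = n ^ (1 / 3)`, and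
the factor `t ^ (1 / 2)` returns as the cost of a rank query. The term `n / z` is at most `n ^ (1 /
3)` once `n ^ 2 ≤ t ^ 3`; otherwise `r ≤ n ^ (1 / 3) * r ^ (1 / 2)`. -/
theorem indep_rounds_le {n r : ℕ} (hrn : r ≤ n) :
    (4 * guessRounds n (r + 1) (basisRounds n (r + 1))
        ((n : ℝ) ^ (1 / 3 : ℝ) * ((r + 1 : ℕ) : ℝ) ^ (1 / 2 : ℝ))
        ((r + 1) ^ 3 ≤ n ^ 2 ∨ r + 1 ≤ 1) + 1 : ℝ) ≤
      1000 * (1 + (n : ℝ) ^ (1 / 3 : ℝ) * (r : ℝ) ^ (1 / 2 : ℝ) *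
        (1 + Real.log ((n : ℝ) / (r : ℝ)))) := by
  set l := Real.log ((n : ℝ) / (r : ℝ)) with hl
  set x := (n : ℝ) ^ (1 / 3 : ℝ)
  set y := (r : ℝ) ^ (1 / 2 : ℝ)
  have hx0 : 0 ≤ x := by positivity
  have hy0 : 0 ≤ y := by positivity
  have square : ∀ a : ℝ, 0 ≤ a → (a ^ (1 / 2 : ℝ)) ^ 2 = a := fun a ha => by
    rw [← Real.rpow_natCast, ← Real.rpow_mul ha]
    norm_num
  have hx : x ^ 3 = n := by
    rw [← Real.rpow_natCast, ← Real.rpow_mul (Nat.cast_nonneg _)]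
    norm_num
  have hy : y ^ 2 = r := square _ (Nat.cast_nonneg _)
  have hl0 : 0 ≤ l := by
    rcases Nat.eq_zero_or_pos r with rfl | hr
    -- For `r = 0` the conventions `n / 0 = 0` and `log 0 = 0` give `l = 0`.
    · simp [hl]
    · refine Real.log_nonneg ?_
      rw [le_div_iff₀ (by exact_mod_cast hr), one_mul]
      exact_mod_cast hrn
  by_cases hsmall : (r + 1) ^ 3 ≤ n ^ 2 ∨ r + 1 ≤ 1
  · rw [guessRounds, if_pos hsmall]
    have hr : (r : ℝ) ≤ x * y := by
      rcases hsmall with h | h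
      · have h1 : ((r ^ 3 : ℕ) : ℝ) ≤ (n ^ 2 : ℕ) := by
          exact_mod_cast le_trans (Nat.pow_le_pow_left r.le_succ 3) h
        rw [Nat.cast_pow, Nat.cast_pow, ← hx, ← hy] at h1
        have h2 : y ≤ x := by
          refine le_of_pow_le_pow_left₀ (n := 6) (by norm_num) hx0 ?_
          calc y ^ 6 = (y ^ 2) ^ 3 := by ring
            _ ≤ (x ^ 3) ^ 2 := h1
            _ = x ^ 6 := by ring
        calc (r : ℝ) = y * y := by rw [← hy]; ring
          _ ≤ x * y := by gcongr
      · have : r = 0 := by omega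
        rw [this, Nat.cast_zero]
        positivity
    have hP : x * y ≤ x * y * (1 + l) := le_mul_of_one_le_right (by positivity) (by linarith)
    push_cast
    nlinarith
  · set w := ((r + 1 : ℕ) : ℝ) ^ (1 / 2 : ℝ)
    have hw : w ^ 2 = (r + 1 : ℕ) := square _ (Nat.cast_nonneg _)
    have hw0 : 0 ≤ w := by positivity
    have hbig := hsmall
    rw [not_or, not_le, not_le] at hbig
    have hr1 : 1 ≤ r := by omega
    have hn1 : 1 ≤ n := hr1.trans hrn
    have hx1 : 1 ≤ x := one_le_of_pow_le hx0 (a := n) (by exact_mod_cast hn1) (m := 3)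
      (by norm_num) hx.ge
    have hw1 : 1 ≤ w := one_le_of_pow_le hw0 (a := (r + 1 : ℕ))
      (by exact_mod_cast Nat.succ_pos r) (m := 2) (by norm_num) hw.ge
    have hwy : w ≤ 2 * y := by
      refine le_of_pow_le_pow_left₀ (n := 2) (by norm_num) (by positivity) ?_
      have h1 : ((r + 1 : ℕ) : ℝ) ≤ 4 * r := by exact_mod_cast (by omega : r + 1 ≤ 4 * r)
      rw [hw, mul_pow, hy]
      linarith
    have hxw : x ≤ w := by
      refine le_of_pow_le_pow_left₀ (n := 6) (by norm_num) hw0 ?_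
      calc x ^ 6 = ((n ^ 2 : ℕ) : ℝ) := by rw [Nat.cast_pow, ← hx]; ring
        _ ≤ (((r + 1) ^ 3 : ℕ) : ℝ) := by exact_mod_cast hbig.1.le
        _ = w ^ 6 := by rw [Nat.cast_pow, ← hw]; ring
    have hz1 : 1 ≤ x * w := one_le_mul_of_one_le_of_one_le hx1 hw1
    have hmain := guessRounds_le (n := n) (t := r + 1) (R := basisRounds n (r + 1)) hz1 hsmall
    have h1 : 2 * (n : ℝ) * (r + 1 : ℕ) / (x * w) ^ 2 = 2 * x := by
      rw [← hw, ← hx]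
      field_simp
    have h2 : 2 * (n : ℝ) / (x * w) ≤ 2 * x := by
      rw [div_le_iff₀ (by linarith), ← hx]
      have : x * (x * x) ≤ x * (x * w) := by gcongr
      nlinarith
    have hlog : Real.log ((n : ℝ) / (r + 1 : ℕ)) ≤ l := by
      refine Real.log_le_log (by positivity) ?_
      have : (0 : ℝ) < r := by exact_mod_cast hr1
      gcongr
      exact Nat.le_succ r
    have h3 := basisRounds_le (Nat.succ_pos r) hl0 hlog
    have h4 : (basisRounds n (r + 1) : ℝ) ≤ 22 * (y * (1 + l)) := by
      refine h3.trans ?_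
      have : w * (1 + l) ≤ 2 * y * (1 + l) := by gcongr
      linarith
    have h5 : (2 * (n : ℝ) * (r + 1 : ℕ) / (x * w) ^ 2 + 2 * n / (x * w) + 1) *
        basisRounds n (r + 1) ≤ 5 * x * (22 * (y * (1 + l))) := by
      refine mul_le_mul ?_ h4 (Nat.cast_nonneg _) (by positivity)
      rw [h1]
      linarith
    have h6 : x * w ≤ 2 * (x * y * (1 + l)) := by
      calc x * w ≤ x * (2 * y) := by gcongr
        _ = 2 * (x * y) := by ring
        _ ≤ 2 * (x * y * (1 + l)) := by
          have : x * y ≤ x * y * (1 + l) :=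
            le_mul_of_one_le_right (by positivity) (by linarith)
          linarith
    have h7 : 5 * x * (22 * (y * (1 + l))) = 110 * (x * y * (1 + l)) := by ring
    have h8 : 0 ≤ x * y * (1 + l) := by positivity
    linarith

open ParallelAlg

/-- The algorithm for truncated matroids with `guessRounds` rounds. -/
theorem exists_truncated {V A : Type*} [Fintype V]
    {oracle : Matroid V → Matroid V → Query V → A} {t N R : ℕ} {z : ℝ} {small : Prop}
    (hI : Simulates oracle (fun M₁ M₂ => indepOracle (M₁.truncateTo t) (M₂.truncateTo t)) 1 1)
    (hR : Simulates oracle (fun M₁ M₂ => rankOracle (M₁.truncateTo t) (M₂.truncateTo t)) N R)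
    (hz : ¬ small → 0 < Fintype.card V → 0 < z) :
    ∃ alg : ParallelAlg (Query V) A (Finset V),
      Within (4 * Fintype.card V * N + (2 * Fintype.card V + 2 * Fintype.card V ^ 2))
        (guessRounds (Fintype.card V) t R z small) alg ∧
      ∀ M₁ M₂ : Matroid V, M₁.E = Set.univ → M₂.E = Set.univ →
        IsMaxCommonIndep (M₁.truncateTo t) (M₂.truncateTo t) (alg.run (oracle M₁ M₂)) := by
  by_cases hsmall : small
  · obtain ⟨alg, h1, h2⟩ := exists_truncated_of_augment hI
    refine ⟨alg, h1.mono (Nat.le_add_left _ _) ?_, h2⟩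
    rw [guessRounds, if_pos hsmall]
  rcases Nat.eq_zero_or_pos (Fintype.card V) with h0 | hpos
  · have := Fintype.card_eq_zero_iff.1 h0
    refine ⟨output ∅, .output _ _, fun M₁ M₂ _ _ => ⟨by simp [IsCommonIndep, run], fun T _ => ?_⟩⟩
    simp [Finset.eq_empty_of_isEmpty T]
  · rw [guessRounds, if_neg hsmall]
    exact exists_truncated_of_auction hI hR (Nat.succ_pos _) (Nat.ceil_pos.2 (hz hsmall hpos))

end MatroidIntersection

theorem theorem1p3 :
    -- rank queries: `O(n^{1/3} r^{1/3})` rounds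
    (∃ (C : ℝ) (p : Polynomial ℕ), ∀ (V : Type*) [Fintype V],
      ∃ alg : ParallelAlg (MatroidIntersection.Query V) ℕ (Finset V),
        ∀ M₁ M₂ : Matroid V, M₁.E = Set.univ → M₂.E = Set.univ →
          ∀ n r : ℕ, n = Fintype.card V → r = MatroidIntersection.answerSize M₁ M₂ →
            MatroidIntersection.IsMaxCommonIndep M₁ M₂
                (alg.run (MatroidIntersection.rankOracle M₁ M₂)) ∧
              alg.maxQueries (MatroidIntersection.rankOracle M₁ M₂) ≤ p.eval n ∧
              (alg.rounds (MatroidIntersection.rankOracle M₁ M₂) : ℝ) ≤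
                C * (1 + (n : ℝ) ^ (1 / 3 : ℝ) * (r : ℝ) ^ (1 / 3 : ℝ))) ∧
    -- independence queries: `O(n^{1/3} r^{1/2} log(n/r))` rounds
    (∃ (C : ℝ) (p : Polynomial ℕ), ∀ (V : Type*) [Fintype V],
      ∃ alg : ParallelAlg (MatroidIntersection.Query V) Bool (Finset V),
        ∀ M₁ M₂ : Matroid V, M₁.E = Set.univ → M₂.E = Set.univ →
          ∀ n r : ℕ, n = Fintype.card V → r = MatroidIntersection.answerSize M₁ M₂ →
            MatroidIntersection.IsMaxCommonIndep M₁ M₂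
                (alg.run (MatroidIntersection.indepOracle M₁ M₂)) ∧
              alg.maxQueries (MatroidIntersection.indepOracle M₁ M₂) ≤ p.eval n ∧
              (alg.rounds (MatroidIntersection.indepOracle M₁ M₂) : ℝ) ≤
                C * (1 + (n : ℝ) ^ (1 / 3 : ℝ) * (r : ℝ) ^ (1 / 2 : ℝ) *
                  (1 + Real.log ((n : ℝ) / (r : ℝ))))) := by
  open MatroidIntersection in
  constructor
  -- The polynomial is `4 * n * N + (2 * n + 2 * n ^ 2)` with `N = 1` query per simulated rank
  -- query.
  · refine ⟨100, 6 * Polynomial.X + 2 * Polynomial.X ^ 2, fun V _ => ?_⟩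
    obtain ⟨alg, halg⟩ := exists_of_truncated (V := V) (A := ℕ) _ fun t ht =>
      exists_truncated (simulates_rank_indep t) (simulates_rank_rank t)
        (z := ((Fintype.card V : ℝ) * t) ^ (1 / 3 : ℝ)) (small := t * t ≤ Fintype.card V ∨ t ≤ 1)
        (fun _ hpos => by positivity)
    refine ⟨alg, fun M₁ M₂ hE₁ hE₂ n r hn hr => ?_⟩
    subst hn hr
    obtain ⟨h1, h2, h3⟩ := halg M₁ M₂ hE₁ hE₂
    refine ⟨h1, h2.trans ?_, le_trans ?_ (rank_rounds_le (answerSize_le_card M₁ M₂))⟩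
    · simp only [Polynomial.eval_add, Polynomial.eval_mul, Polynomial.eval_pow,
        Polynomial.eval_X, Polynomial.eval_ofNat]
      omega
    · exact_mod_cast h3
  -- The same polynomial with `N = 2 * n`.
  · refine ⟨1000, 2 * Polynomial.X + 10 * Polynomial.X ^ 2, fun V _ => ?_⟩
    obtain ⟨alg, halg⟩ := exists_of_truncated (V := V) (A := Bool) _ fun t ht =>
      exists_truncated (simulates_indep_indep t) (simulates_indep_rank ht)
        (z := (Fintype.card V : ℝ) ^ (1 / 3 : ℝ) * (t : ℝ) ^ (1 / 2 : ℝ))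
        (small := t ^ 3 ≤ Fintype.card V ^ 2 ∨ t ≤ 1) (fun _ hpos => by positivity)
    refine ⟨alg, fun M₁ M₂ hE₁ hE₂ n r hn hr => ?_⟩
    subst hn hr
    obtain ⟨h1, h2, h3⟩ := halg M₁ M₂ hE₁ hE₂
    refine ⟨h1, h2.trans ?_, le_trans ?_ (indep_rounds_le (answerSize_le_card M₁ M₂))⟩
    · simp only [Polynomial.eval_add, Polynomial.eval_mul, Polynomial.eval_pow,
        Polynomial.eval_X, Polynomial.eval_ofNat]
      nlinarith
    · exact_mod_cast h3
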